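/- An energy game is played by Alice and Bob on a finite directed graph $G=(V,E)$ in which every node has out-degree at least one, whose nodes are partitioned into Alice's nodes $V_A$ and Bob's nodes $V_B$, and in which every edge $(u,v)$ has an integer weight $w(u,v)$. A (positional) strategy $\sigma$ of Alice (respectively $\tau$ of Bob) assigns to every $u\in V_A$ (respectively $u\in V_B$) a node $v$ with $(u,v)\in E$. In the graph $G(\sigma,\tau)$ formed by the chosen edges every node has exactly one out-edge; let $C$ be the unique cycle reachable from $s$ in $G(\sigma,\tau)$. Put $e^*_{G(\sigma,\tau),w}(s)=\infty$ if $w(C)<0$, and otherwise $e^*_{G(\sigma,\tau),w}(s)=\max\{0,-\min_P w(P)\}$, where $P$ ranges over the simple paths of $G(\sigma,\tau)$ starting at $s$ (including the path of length $0$) and $w$ of a cycle or path is the sum of its edge weights. The minimal sufficient energy is $e^*_{G,w}(s)=\min_\sigma\max_\tau e^*_{G(\sigma,\tau),w}(s)$. The decision problem of energy games is: given $(G,w)$ and a node $s\in V$, with the weights written in binary, is $e^*_{G,w}(s)$ finite? A graph $G$ is called complete bipartite if no edge joins two nodes of the same player, and for all nodes $u,v$ belonging to different players $(u,v)\in E$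 (thus both directions are present; $|V_A|=|V_B|$ is not required). **Theorem.** The decision problem of energy games on complete bipartite graphs is polynomial-time equivalent to the decision problem of energy games on general graphs. That is, for each of the two problems there is a polynomial-time computable function that maps its instances to instances of the other problem and preserves the answer. -/

import Mathlib

/-- A finite weighted game graph on the node set `V`: `alice u = true` means `u ∈ V_A` and
`alice u = false` means `u ∈ V_B`; `weight u v = some z` means that `(u, v)` is an edge of weight
`z`, and `weight u v = none` that it is not an edge. Every node has out-degree at least one. -/
structure GameGraph (V : Type) where
  alice : V → Bool
  weight : V → V → Option ℤ
  exists_edge : ∀ u, ∃ v, (weight u v).isSome = true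

namespace GameGraph

variable {V : Type} (G : GameGraph V)

/-- `(u, v)` is an edge. -/
def Adj (u v : V) : Prop := (G.weight u v).isSome = true

/-- The weight of the edge `(u, v)` (only used on edges). -/
def w (u v : V) : ℤ := (G.weight u v).getD 0

/-- Positional strategies of Alice. -/
def AliceStrategy : Type :=
  {σ : {u : V // G.alice u = true} → V // ∀ u, G.Adj u.1 (σ u)}

/-- Positional strategies of Bob. -/
def BobStrategy : Type :=
  {τ : {u : V // G.alice u = false} → V // ∀ u, G.Adj u.1 (τ u)}

variable {G}

/-- The unique out-neighbour of `u` in the graph `G(σ, τ)`. -/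
def next (σ : G.AliceStrategy) (τ : G.BobStrategy) (u : V) : V :=
  if h : G.alice u = true then σ.1 ⟨u, h⟩ else τ.1 ⟨u, Bool.eq_false_iff.mpr h⟩

/-- The node reached after `i` rounds from `s` in `G(σ, τ)`. -/
def play (σ : G.AliceStrategy) (τ : G.BobStrategy) (s : V) (i : ℕ) : V :=
  (next σ τ)^[i] s

/-- `w(P_i)`: the weight of the path of length `i` from `s` in `G(σ, τ)`. -/
def pathWeight (σ : G.AliceStrategy) (τ : G.BobStrategy) (s : V) (i : ℕ) : ℤ :=
  ∑ j ∈ Finset.range i, G.w (play σ τ s j) (play σ τ s (j + 1))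

open scoped Classical in
/-- `w(C)` for the unique cycle `C` reachable from `s` in `G(σ, τ)`. The nodes of `C` are the nodes
on the play from `s` that lie on a cycle of `G(σ, τ)`, and the edges of `C` are their out-edges. -/
noncomputable def cycleWeight [Fintype V] (σ : G.AliceStrategy) (τ : G.BobStrategy) (s : V) : ℤ :=
  ∑ v : V with v ∈ Function.periodicPts (next σ τ) ∧ ∃ i, play σ τ s i = v, G.w v (next σ τ v)

/-- The minimal sufficient energy at `s` for the pair `(σ, τ)`: infinite if `w(C) < 0`, and
otherwise `max {0, - min w(P_i)}` over the simple paths `P_i` from `s` in `G(σ, τ)`. -/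
noncomputable def pairEnergy [Fintype V] (σ : G.AliceStrategy) (τ : G.BobStrategy) (s : V) : ℕ∞ :=
  if cycleWeight σ τ s < 0 then ⊤
  else ⨆ (i : ℕ) (_ : Set.InjOn (play σ τ s) (Set.Iic i)), ((- pathWeight σ τ s i).toNat : ℕ∞)

variable (G)

/-- The minimal sufficient energy `e*_{G,w}(s)`, the minimum over Alice's strategies of the maximum
over Bob's strategies (both sets of strategies are finite and non-empty). -/
noncomputable def minEnergy [Fintype V] (s : V) : ℕ∞ :=
  ⨅ σ : G.AliceStrategy, ⨆ τ : G.BobStrategy, pairEnergy σ τ s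

/-- No edge joins two nodes of the same player, and all edges between nodes of different players,
in both directions, are present. -/
def IsCompleteBipartite : Prop :=
  (∀ u v, G.alice u = G.alice v → ¬ G.Adj u v) ∧ (∀ u v, G.alice u ≠ G.alice v → G.Adj u v)

end GameGraph

/-- An instance of the decision problem of energy games: a weighted game graph on the nodes
`0, …, n - 1` and a node `s`. -/
structure EnergyInstance where
  n : ℕ
  graph : GameGraph (Fin n)
  s : Fin n

namespace EnergyInstance

open Computability

/-- An entry of the weight matrix. An edge weight is written in binary, after a bit for its sign. -/
def encodeEntry : Option ℤ → List Γ'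
  | none => [Γ'.blank]
  | some z =>
      Γ'.bra :: Γ'.bit (decide (z < 0)) :: ((encodeNat z.natAbs).map Γ'.bit ++ [Γ'.ket])

/-- Two bits for a node: its owner, and whether it is the given node `s`. -/
def encodeNode (I : EnergyInstance) (u : Fin I.n) : List Γ' :=
  [Γ'.bit (I.graph.alice u), Γ'.bit (decide (u = I.s))]

/-- A row of the weight matrix. -/
def encodeRow (I : EnergyInstance) (u : Fin I.n) : List Γ' :=
  (List.finRange I.n).flatMap (fun v => encodeEntry (I.graph.weight u v)) ++ [Γ'.comma]

/-- The encoding of an instance: the list of its nodes, then its weight matrix row by row. -/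
def encode (I : EnergyInstance) : List Γ' :=
  (List.finRange I.n).flatMap I.encodeNode ++ Γ'.comma :: (List.finRange I.n).flatMap I.encodeRow

theorem encodeEntry_append_cancel {a b : Option ℤ} {r t : List Γ'}
    (h : encodeEntry a ++ r = encodeEntry b ++ t) : a = b ∧ r = t := by
  have key : ∀ (l m : List Bool) (r t : List Γ'),
      l.map Γ'.bit ++ Γ'.ket :: r = m.map Γ'.bit ++ Γ'.ket :: t → l = m ∧ r = t := by
    intro l
    induction l with
    | nil => intro m r t h; cases m <;> simp_all
    | cons x l ih =>
      intro m r t h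
      cases m with
      | nil => simp at h
      | cons y m =>
        simp only [List.map_cons, List.cons_append, List.cons.injEq, Γ'.bit.injEq] at h
        obtain ⟨h1, h2⟩ := ih m r t h.2
        exact ⟨by rw [h.1, h1], h2⟩
  cases a with
  | none => cases b <;> simp_all [encodeEntry]
  | some a =>
    cases b with
    | none => simp [encodeEntry] at h
    | some b =>
      simp only [encodeEntry, List.cons_append, List.append_assoc, List.nil_append,
        List.cons.injEq, true_and, Γ'.bit.injEq, decide_eq_decide] at h
      obtain ⟨h1, h2⟩ := key _ _ _ _ h.2
      have h3 : a.natAbs = b.natAbs := by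
        rw [← decode_encodeNat a.natAbs, h1, decode_encodeNat]
      refine ⟨?_, h2⟩
      congr 1
      have := h.1
      omega

theorem flatMap_append_cancel {ι : Type} {f g : ι → List Γ'} (L : List ι) {r t : List Γ'}
    (h : L.flatMap f ++ r = L.flatMap g ++ t)
    (hfg : ∀ i ∈ L, ∀ r t, f i ++ r = g i ++ t → f i = g i ∧ r = t) :
    (∀ i ∈ L, f i = g i) ∧ r = t := by
  induction L with
  | nil => simpa using h
  | cons i L ih =>
    simp only [List.flatMap_cons, List.append_assoc] at h
    obtain ⟨h1, h2⟩ := hfg i (by simp) _ _ h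
    obtain ⟨h3, h4⟩ := ih h2 (fun j hj => hfg j (by simp [hj]))
    exact ⟨by simpa using ⟨h1, h3⟩, h4⟩

/-- Different instances have different encodings. -/
theorem encode_injective : Function.Injective encode := by
  have key : ∀ l m r t : List Γ', Γ'.comma ∉ l → Γ'.comma ∉ m →
      l ++ Γ'.comma :: r = m ++ Γ'.comma :: t → l = m ∧ r = t := by
    intro l
    induction l with
    | nil => intro m r t _ hm h; cases m <;> simp_all
    | cons x l ih =>
      intro m r t hl hm h
      cases m with
      | nil => simp_all
      | cons y m =>
        simp only [List.cons_append, List.cons.injEq] at h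
        obtain ⟨h1, h2⟩ := ih m r t (by simp_all) (by simp_all) h.2
        exact ⟨by rw [h.1, h1], h2⟩
  rintro ⟨n, ⟨a, w, hw⟩, s⟩ ⟨m, ⟨b, x, hx⟩, t⟩ h
  obtain ⟨h1, h2⟩ := key _ _ _ _ (by simp [encodeNode]) (by simp [encodeNode]) h
  have hnm : n = m := by
    have := congrArg List.length h1
    simp [encodeNode, List.length_flatMap] at this
    omega
  subst hnm
  obtain ⟨h3, -⟩ := flatMap_append_cancel (List.finRange n) (congrArg (· ++ []) h1)
    (by intro i _ r t h; simpa [encodeNode, and_assoc] using h)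
  have hrow : ∀ {i : Fin n} {r t : List Γ'},
      (List.finRange n).flatMap (fun j => encodeEntry (w i j)) ++ r =
        (List.finRange n).flatMap (fun j => encodeEntry (x i j)) ++ t →
      (∀ j ∈ List.finRange n, encodeEntry (w i j) = encodeEntry (x i j)) ∧ r = t := by
    intro i r t h
    refine flatMap_append_cancel (List.finRange n) h ?_
    intro j _ r t h
    obtain ⟨h7, h8⟩ := encodeEntry_append_cancel h
    exact ⟨by rw [h7], h8⟩
  obtain ⟨h4, -⟩ := flatMap_append_cancel (List.finRange n) (congrArg (· ++ []) h2) (by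
      intro i _ r t h
      simp only [encodeRow, List.append_assoc] at h
      obtain ⟨h5, h6⟩ := hrow h
      refine ⟨?_, by simpa using h6⟩
      simp only [encodeRow]
      rw [List.flatMap_congr h5])
  have ha : a = b := by
    funext i
    have := h3 i (by simp)
    simp [encodeNode] at this
    exact this.1
  have hs : s = t := by
    have := h3 s (by simp)
    simp [encodeNode] at this
    exact this.2
  have hwx : w = x := by
    funext i j
    have h5 := h4 i (by simp)
    simp only [encodeRow] at h5
    obtain ⟨h6, -⟩ := hrow h5
    exact (encodeEntry_append_cancel (r := []) (t := []) (by rw [h6 j (by simp)])).1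
  subst ha hs hwx
  rfl

end EnergyInstance

/-- A decision problem: a set of instances with an injective encoding by words over the alphabet
`Γ`, and the set of its yes-instances. -/
structure DecisionProblem (Γ : Type) where
  Instance : Type
  encode : Instance → List Γ
  encode_injective : Function.Injective encode
  yes : Instance → Prop

namespace DecisionProblem

variable {Γ Δ : Type}

/-- There is a function, computable by a (multi-stack) Turing machine in a number of steps bounded
by a polynomial in the length of its input, that maps instances of `P` to instances of `Q` and
preserves the answer. -/
def PolyTimeReducible (P : DecisionProblem Γ) (Q : DecisionProblem Δ) : Prop :=
  ∃ f : P.Instance → Q.Instance,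
    Nonempty (Turing.TM2ComputableInPolyTime P.encode Q.encode f) ∧ ∀ x, P.yes x ↔ Q.yes (f x)

/-- Each of the two problems has a polynomial-time reduction to the other one. -/
def PolyTimeEquivalent (P : DecisionProblem Γ) (Q : DecisionProblem Δ) : Prop :=
  P.PolyTimeReducible Q ∧ Q.PolyTimeReducible P

end DecisionProblem

/-- The decision problem of energy games on general graphs: is `e*_{G,w}(s)` finite? -/
def energyDecision : DecisionProblem Computability.Γ' where
  Instance := EnergyInstance
  encode := EnergyInstance.encode
  encode_injective := EnergyInstance.encode_injective
  yes I := I.graph.minEnergy I.s < ⊤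

/-- The decision problem of energy games on complete bipartite graphs. -/
def completeBipartiteEnergyDecision : DecisionProblem Computability.Γ' where
  Instance := {I : EnergyInstance // I.graph.IsCompleteBipartite}
  encode I := I.1.encode
  encode_injective := EnergyInstance.encode_injective.comp Subtype.val_injective
  yes I := I.1.graph.minEnergy I.1.s < ⊤

/-! One direction is an inclusion of instances. For the other, every node of `G` gets a copy for
either player. The owner of `x` moves from his copy as in `G`, the opponent's copy forwards to the
owner's at weight 0, and each missing edge between copies of different players is added with a
penalty against its mover: `M` if it leads to a copy of `s`, `2 * M` otherwise.

Finite energy means that Alice has a choice of edges making all reachable closed walks nonnegative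
(`minEnergy_lt_top_iff`), so only cycles matter. Let a player use genuine (unpenalized) edges inside
a region `R` containing `s`, and return to `s` from outside. If the opponent leaves `R` by a
penalized edge, he pays `2 * M`, which covers the return and leaves a profit of `M`; a penalized
edge to `s` yields that profit at once. All other losses are at most `W` per step, where `W` bounds
the weights, and some cycle has at most `2 * |V|` steps. So with `M > 2 * |V| * W` one penalized
step of the opponent from `R` decides the cycle. Without such a step the play stays in `R` on
genuine edges, and a cycle projects to a closed walk of `G` (`exists_closed_completion`).

For Alice, `R` consists of the nodes from which her choice wins in `G` (`AliceWins.completion`). For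
Bob, it is the play of his answer in `G` to the choice read off from Alice's choice in the
completion (`AliceWins.of_completion`). As the answer may depend on her choice, no determinacy
theorem is needed.

Taking `M = 2 ^ L` with `L` the input length makes `M` large enough and its numeral easy to write:
`L` zeros and a one. A stack program writes the new instance in cubic time (`exec_reduction`), and
such programs compile to Turing machines (`computableInPolyTime`). -/

/-! ### Closed walks of a self-map -/

section ClosedWalks

open Function

variable {V : Type} {f : V → V} {c : V → ℤ}

theorem birkhoffSum_mul_of_closed {q : ℕ} {x : V} (hx : f^[q] x = x) (m : ℕ) :
    birkhoffSum f c (q * m) x = m * birkhoffSum f c q x := by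
  induction m with
  | zero => simp
  | succ m ih =>
    have hm : f^[q * m] x = x := IsPeriodicPt.mul_const (m := q) hx m
    rw [Nat.mul_succ, birkhoffSum_add, ih, hm]
    push_cast
    ring

theorem birkhoffSum_iterate_of_closed {q : ℕ} {x : V} (hx : f^[q] x = x) (k : ℕ) :
    birkhoffSum f c q (f^[k] x) = birkhoffSum f c q x := by
  have h1 := birkhoffSum_add f c q k x
  have h2 := birkhoffSum_add f c k q x
  rw [hx] at h1
  rw [add_comm k q] at h2
  linarith

theorem iterate_closed {q : ℕ} {x : V} (hx : f^[q] x = x) (k : ℕ) :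
    f^[q] (f^[k] x) = f^[k] x := by
  rw [← iterate_add_apply, add_comm, iterate_add_apply, hx]

/-- Two closed walks on the same cycle have proportional weights. -/
theorem birkhoffSum_closed_proportional {q r : ℕ} {s : V} {i j : ℕ}
    (hi : f^[q] (f^[i] s) = f^[i] s) (hj : f^[r] (f^[j] s) = f^[j] s) :
    r * birkhoffSum f c q (f^[i] s) = q * birkhoffSum f c r (f^[j] s) := by
  rw [← birkhoffSum_iterate_of_closed hi j, ← birkhoffSum_iterate_of_closed hj i,
    ← iterate_add_apply, ← iterate_add_apply, add_comm j i]
  have h1 : f^[q] (f^[i + j] s) = f^[i + j] s := by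
    have := iterate_closed hi j
    rwa [← iterate_add_apply f j i, add_comm j i] at this
  have h2 : f^[r] (f^[i + j] s) = f^[i + j] s := by
    have := iterate_closed hj i
    rwa [← iterate_add_apply f i j] at this
  rw [← birkhoffSum_mul_of_closed h1, ← birkhoffSum_mul_of_closed h2, mul_comm]

/-- All closed walks on the play of `f` from `s` have nonnegative weight. -/
def NonnegFrom (f : V → V) (c : V → ℤ) (s : V) : Prop :=
  ∀ i q, 0 < q → f^[q] (f^[i] s) = f^[i] s → 0 ≤ birkhoffSum f c q (f^[i] s)

/-- A play of a self-map runs into a single cycle, so the sign of one closed walk on it decides all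
of them. -/
theorem nonnegFrom_iff_of_closed {s : V} {i q : ℕ} (hq : 0 < q)
    (h : f^[q] (f^[i] s) = f^[i] s) :
    NonnegFrom f c s ↔ 0 ≤ birkhoffSum f c q (f^[i] s) := by
  refine ⟨fun H => H i q hq h, fun H j r hr hj => ?_⟩
  have := birkhoffSum_closed_proportional (c := c) h hj
  have h1 : (0 : ℤ) < q := by exact_mod_cast hq
  have h2 : (0 : ℤ) ≤ r * birkhoffSum f c q (f^[i] s) := by positivity
  rw [this] at h2
  exact nonneg_of_mul_nonneg_right h2 h1

/-- Pigeonhole. Passing to the minimal period gives the bound on `q` against which the size of the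
penalties is measured. -/
theorem exists_closed [Fintype V] (f : V → V) (s : V) :
    ∃ i q, 0 < q ∧ q ≤ Fintype.card V ∧ f^[q] (f^[i] s) = f^[i] s := by
  obtain ⟨i, j, hij, h⟩ := Finite.exists_ne_map_eq_of_infinite (fun i => f^[i] s)
  wlog hlt : i < j generalizing i j
  · exact this j i hij.symm h.symm (by omega)
  have hp : f^[i] s ∈ periodicPts f := by
    refine ⟨j - i, by omega, ?_⟩
    change f^[j - i] (f^[i] s) = f^[i] s
    rw [← iterate_add_apply, Nat.sub_add_cancel hlt.le]
    exact h.symm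
  exact ⟨i, _, minimalPeriod_pos_of_mem_periodicPts hp, minimalPeriod_le_card,
    iterate_minimalPeriod⟩

/-- A closed walk has positive weight if, up to a potential, every step costs at most `W` and some
step gains at least `M`. -/
theorem birkhoffSum_pos_of_potential {q : ℕ} {x : V} (φ : V → ℤ) {W M : ℤ} (hW : 0 ≤ W)
    (hx : f^[q] x = x) (hstep : ∀ v, φ (f v) - φ v - W ≤ c v) {j : ℕ} (hj : j < q)
    (hbad : φ (f^[j + 1] x) - φ (f^[j] x) + M ≤ c (f^[j] x)) (hM : q * W < M) :
    0 < birkhoffSum f c q x := by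
  -- Around a closed walk the potential differences cancel, so they may be subtracted from the
  -- costs. Step `j` then gains `M` and every other step loses at most `W`.
  have htel : ∑ k ∈ Finset.range q, (φ (f^[k + 1] x) - φ (f^[k] x)) = 0 := by
    rw [Finset.sum_range_sub (fun k => φ (f^[k] x)), hx]
    simp
  have hsum : birkhoffSum f c q x =
      ∑ k ∈ Finset.range q, (c (f^[k] x) - (φ (f^[k + 1] x) - φ (f^[k] x))) := by
    rw [Finset.sum_sub_distrib, htel, sub_zero]
    rfl
  rw [hsum, ← Finset.add_sum_erase _ _ (Finset.mem_range.mpr hj)]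
  have h2 : ((Finset.range q).erase j).card • (-W) ≤ ∑ k ∈ (Finset.range q).erase j,
      (c (f^[k] x) - (φ (f^[k + 1] x) - φ (f^[k] x))) := by
    refine Finset.card_nsmul_le_sum _ _ _ fun k _ => ?_
    have := hstep (f^[k] x)
    rw [iterate_succ_apply']
    linarith
  have h3 : (((Finset.range q).erase j).card : ℤ) ≤ q := by
    exact_mod_cast (Finset.card_erase_le).trans (by simp)
  rw [nsmul_eq_mul] at h2
  nlinarith

end ClosedWalks

/-! ### Finite energy in terms of closed walks -/

namespace GameGraph

open Function

variable {V : Type}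

/-- The weight of the edge chosen by `f` at `v`. -/
def cost (G : GameGraph V) (f : V → V) (v : V) : ℤ := G.w v (f v)

/-- `f` chooses an edge at every node. -/
def IsChoice (G : GameGraph V) (f : V → V) : Prop := ∀ u, G.Adj u (f u)

theorem exists_isChoice (G : GameGraph V) : ∃ f, G.IsChoice f := by
  choose f hf using G.exists_edge
  exact ⟨f, hf⟩

/-- Alice has a choice of edges that makes all cycles reachable from `s` nonnegative. -/
def AliceWins (G : GameGraph V) (s : V) : Prop :=
  ∃ σ, G.IsChoice σ ∧ ∀ f, G.IsChoice f → (∀ u, G.alice u = true → f u = σ u) →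
    NonnegFrom f (G.cost f) s

variable {G : GameGraph V}

theorem isChoice_next (σ : G.AliceStrategy) (τ : G.BobStrategy) : G.IsChoice (next σ τ) := by
  intro u
  unfold next
  split_ifs with h
  exacts [σ.2 ⟨u, h⟩, τ.2 ⟨u, _⟩]

theorem cycleWeight_nonneg_iff [Fintype V] (σ : G.AliceStrategy) (τ : G.BobStrategy) (s : V) :
    0 ≤ cycleWeight σ τ s ↔ NonnegFrom (next σ τ) (G.cost (next σ τ)) s := by
  classical
  set f := next σ τ with hf
  obtain ⟨i, q, hq, -, hc⟩ := exists_closed f s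
  have hp : f^[i] s ∈ periodicPts f := ⟨q, hq, hc⟩
  rw [nonnegFrom_iff_of_closed (minimalPeriod_pos_of_mem_periodicPts hp)
    (iterate_minimalPeriod (f := f) (x := f^[i] s))]
  suffices h : cycleWeight σ τ s =
      birkhoffSum f (G.cost f) (minimalPeriod f (f^[i] s)) (f^[i] s) by rw [h]
  unfold cycleWeight birkhoffSum
  rw [← Finset.sum_image (f := G.cost f) (g := fun k => f^[k] (f^[i] s))]
  · refine Finset.sum_congr ?_ fun v _ => rfl
    ext v
    simp only [Finset.mem_filter, Finset.mem_univ, true_and, Finset.mem_image, Finset.mem_range]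
    constructor
    · rintro ⟨⟨r, hr, hv⟩, j, rfl⟩
      change f^[r] (f^[j] s) = f^[j] s at hv
      -- Going `i` times round a closed walk of length `r` takes `r * i ≥ i` further steps, so the
      -- play meets `f^[j] s` again after `f^[i] s`.
      obtain ⟨k, hk⟩ : ∃ k, f^[k] (f^[i] s) = f^[j] s := by
        rw [← IsPeriodicPt.mul_const (m := r) (x := f^[j] s) hv i]
        refine ⟨r * i + j - i, ?_⟩
        have := Nat.le_mul_of_pos_left i hr
        rw [← iterate_add_apply, ← iterate_add_apply,
          show r * i + j - i + i = r * i + j by omega]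
      refine ⟨k % minimalPeriod f (f^[i] s),
        Nat.mod_lt _ (minimalPeriod_pos_of_mem_periodicPts hp), ?_⟩
      rw [iterate_mod_minimalPeriod_eq, hk]
      rfl
    · rintro ⟨k, -, rfl⟩
      refine ⟨⟨q, hq, iterate_closed hc k⟩, k + i, ?_⟩
      unfold play
      rw [iterate_add_apply]
  · intro a ha b hb hab
    exact iterate_injOn_Iio_minimalPeriod (by simpa using ha) (by simpa using hb) hab

theorem pairEnergy_lt_top_iff [Fintype V] (σ : G.AliceStrategy) (τ : G.BobStrategy) (s : V) :
    pairEnergy σ τ s < ⊤ ↔ 0 ≤ cycleWeight σ τ s := by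
  unfold pairEnergy
  split_ifs with h
  · simpa using h
  · simp only [not_lt.mp h, iff_true]
    -- A simple path has fewer than `card V` edges, so the supremum is at most the sum of these
    -- finitely many terms.
    refine lt_of_le_of_lt (b := ((∑ i ∈ Finset.range (Fintype.card V),
      (-pathWeight σ τ s i).toNat : ℕ) : ℕ∞)) ?_ (ENat.natCast_lt_top _)
    refine iSup₂_le fun i hi => ?_
    have hcard : i + 1 ≤ Fintype.card V := by
      have h1 := Finset.card_le_card_of_injOn (s := Finset.range (i + 1)) (t := Finset.univ)
        (play σ τ s) (by simp) (hi.mono fun k hk => by simpa [Nat.lt_succ_iff] using hk)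
      simpa using h1
    exact_mod_cast Finset.single_le_sum (f := fun i => (-pathWeight σ τ s i).toNat)
      (fun _ _ => Nat.zero_le _) (Finset.mem_range.mpr hcard)

/-- The supremum over Bob's finitely many strategies is attained, so it is finite as soon as each
pair has finite energy. A pair of strategies is the same as one choice `f` on all nodes; the values
of `σ` in `AliceWins` at Bob's nodes play no role. -/
theorem minEnergy_lt_top_iff [Fintype V] (s : V) : G.minEnergy s < ⊤ ↔ G.AliceWins s := by
  classical
  have hB : Finite G.BobStrategy := Subtype.finite
  unfold minEnergy
  rw [iInf_lt_iff]
  have hsup : ∀ σ : G.AliceStrategy, (⨆ τ : G.BobStrategy, pairEnergy σ τ s) < ⊤ ↔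
      ∀ τ : G.BobStrategy, NonnegFrom (next σ τ) (G.cost (next σ τ)) s := by
    intro σ
    obtain ⟨g, hg⟩ := G.exists_isChoice
    have hN : Nonempty G.BobStrategy := ⟨⟨fun u => g u, fun u => hg u⟩⟩
    simp only [← cycleWeight_nonneg_iff, ← pairEnergy_lt_top_iff]
    refine ⟨fun h τ => (le_iSup _ τ).trans_lt h, fun h => ?_⟩
    obtain ⟨τ, hτ⟩ := exists_eq_ciSup_of_finite (f := fun τ => pairEnergy σ τ s)
    rw [← hτ]
    exact h τ
  simp only [hsup]
  constructor
  · rintro ⟨σ, hσ⟩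
    obtain ⟨g, hg⟩ := G.exists_isChoice
    refine ⟨next σ ⟨fun u => g u, fun u => hg u⟩, isChoice_next _ _, fun f hf hfσ => ?_⟩
    have h := hσ ⟨fun u => f u, fun u => hf u⟩
    suffices hn : next σ ⟨fun u => f u, fun u => hf u⟩ = f by rwa [hn] at h
    funext u
    by_cases hu : G.alice u = true
    · rw [hfσ u hu]
      simp [next, hu]
    · simp [next, hu]
  · rintro ⟨σ, hσ, h⟩
    refine ⟨⟨fun u => σ u, fun u => hσ u⟩, fun τ => h _ (isChoice_next _ _) fun u hu => ?_⟩
    simp [next, hu]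

end GameGraph

/-! ### The complete bipartite completion and its cycles -/

namespace GameGraph

open Function

variable {V : Type}

/-- The weight of a non-edge to a copy of `u`, against the player who uses it (Alice if `p`). It is
cheaper to return to `s` than to go anywhere else. -/
def penalty [DecidableEq V] (s : V) (M : ℤ) (p : Bool) (u : V) : ℤ :=
  (if p = true then -1 else 1) * (if u = s then M else 2 * M)

/-- The complete bipartite graph with a copy of each node of `G` for either player. The owner of `x`
moves from his copy of `x` as in `G`, the other player forwards to the copy of the owner, and all
other edges carry a penalty. -/
def completion [DecidableEq V] (G : GameGraph V) (s : V) (M : ℤ) : GameGraph (V × Bool) where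
  alice x := x.2
  weight x y :=
    if x.2 = y.2 then none
    else some (if G.alice x.1 = x.2 then (G.weight x.1 y.1).getD (penalty s M x.2 y.1)
      else if x.1 = y.1 then 0 else penalty s M x.2 y.1)
  exists_edge x := ⟨(s, !x.2), by simp⟩

variable [DecidableEq V] {G : GameGraph V} {s : V} {M : ℤ}

theorem completion_isCompleteBipartite : (G.completion s M).IsCompleteBipartite := by
  constructor
  · intro u v h
    simp only [completion] at h
    simp [Adj, completion, h]
  · intro u v h
    simp only [completion, ne_eq] at h
    simp [Adj, completion, h]

/-- The edge from the copy of `x` of the player `b` to a copy of `u` carries no penalty. -/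
def Genuine (G : GameGraph V) (b : Bool) (x u : V) : Prop :=
  if G.alice x = b then G.Adj x u else x = u

theorem IsChoice.completion_snd {F : V × Bool → V × Bool} (hF : (G.completion s M).IsChoice F)
    (x : V × Bool) : (F x).2 = !x.2 := by
  have h := hF x
  by_contra hne
  have h2 : x.2 = (F x).2 := by
    revert hne
    cases (F x).2 <;> cases x.2 <;> simp
  simp [Adj, completion, h2] at h

theorem cost_completion {F : V × Bool → V × Bool} (hF : (G.completion s M).IsChoice F)
    (x : V × Bool) : (G.completion s M).cost F x =
      if G.alice x.1 = x.2 then (G.weight x.1 (F x).1).getD (penalty s M x.2 (F x).1)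
      else if x.1 = (F x).1 then 0 else penalty s M x.2 (F x).1 := by
  have h : ¬ x.2 = (F x).2 := by simp [hF.completion_snd x]
  unfold cost w completion
  simp only [if_neg h, Option.getD_some]

theorem cost_completion_of_genuine {F : V × Bool → V × Bool}
    (hF : (G.completion s M).IsChoice F) (x : V × Bool) (h : G.Genuine x.2 x.1 (F x).1) :
    (G.completion s M).cost F x = if G.alice x.1 = x.2 then G.w x.1 (F x).1 else 0 := by
  rw [cost_completion hF]
  unfold Genuine Adj at h
  split_ifs at h ⊢ with h3
  · obtain ⟨z, hz⟩ := Option.isSome_iff_exists.mp h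
    simp [w, hz]
  · rfl

theorem cost_completion_of_not_genuine {F : V × Bool → V × Bool}
    (hF : (G.completion s M).IsChoice F) (x : V × Bool) (h : ¬ G.Genuine x.2 x.1 (F x).1) :
    (G.completion s M).cost F x = penalty s M x.2 (F x).1 := by
  rw [cost_completion hF]
  unfold Genuine Adj at h
  split_ifs at h ⊢ with h3
  · rw [Option.not_isSome_iff_eq_none.mp h]
    rfl
  · rfl

/-- A play of the completion that only uses genuine edges projects to a play of `G`. -/
theorem exists_iterate_eq_of_genuine {F : V × Bool → V × Bool} {g : V → V}
    (hF : (G.completion s M).IsChoice F) {x : V}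
    (hreal : ∀ j, G.Genuine (F^[j] (x, G.alice x)).2 (F^[j] (x, G.alice x)).1
      (F (F^[j] (x, G.alice x))).1)
    (hg : ∀ j y, F^[j] (x, G.alice x) = (y, G.alice y) → (F (y, G.alice y)).1 = g y) (m : ℕ) :
    ∃ k, m ≤ k ∧ F^[k] (x, G.alice x) = (g^[m] x, G.alice (g^[m] x)) ∧
      birkhoffSum F ((G.completion s M).cost F) k (x, G.alice x) =
        birkhoffSum g (G.cost g) m x := by
  induction m with
  | zero => exact ⟨0, le_rfl, rfl, by simp⟩
  | succ m ih =>
    obtain ⟨k, hmk, hk, hsum⟩ := ih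
    set y := g^[m] x with hy
    have hFy := hg k y hk
    have hr := hreal k
    rw [hk] at hr
    have hc := cost_completion_of_genuine hF _ hr
    simp only [if_true, hFy] at hc
    have h1 : F^[k + 1] (x, G.alice x) = (g y, !G.alice y) := by
      rw [iterate_succ_apply', hk]
      exact Prod.ext hFy (hF.completion_snd _)
    have hs1 : birkhoffSum F ((G.completion s M).cost F) (k + 1) (x, G.alice x) =
        birkhoffSum g (G.cost g) (m + 1) x := by
      rw [birkhoffSum_succ, birkhoffSum_succ, hsum, hk, hc]
      rfl
    rw [iterate_succ_apply', ← hy]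
    -- A move of `G` arrives at the opponent's copy of `g y`. If the mover owns `g y` as well, one
    -- forwarding step of weight 0 is inserted.
    by_cases hal : G.alice (g y) = !G.alice y
    · exact ⟨k + 1, by omega, by rw [h1, hal], hs1⟩
    · have hr1 := hreal (k + 1)
      rw [h1] at hr1
      have hc1 := cost_completion_of_genuine hF _ hr1
      simp only [hal, if_false] at hc1
      unfold Genuine at hr1
      simp only [hal, if_false] at hr1
      refine ⟨k + 2, by omega, ?_, ?_⟩
      · rw [iterate_succ_apply', h1]
        refine Prod.ext hr1.symm ((hF.completion_snd _).trans ?_)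
        revert hal
        simp only
        cases G.alice (g y) <;> cases G.alice y <;> simp
      · rw [birkhoffSum_succ, hs1, h1, hc1, add_zero]

/-- Let the player `p` stay inside `R` with genuine edges and return to `s` from outside of `R`, and
let the genuine edges of the other player not leave `R`. Then the play either closes a walk that is
good for `p`, or a walk that projects to a closed walk of `G` inside `R`. -/
theorem exists_closed_completion [Fintype V] {F : V × Bool → V × Bool} {g : V → V}
    (hF : (G.completion s M).IsChoice F) (p : Bool) (R : Set V) (hs : s ∈ R)
    (h1 : ∀ x ∈ R, G.Genuine p x (F (x, p)).1 ∧ (F (x, p)).1 ∈ R)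
    (h2 : ∀ x ∉ R, (F (x, p)).1 = s)
    (h3 : ∀ x ∈ R, G.Genuine (!p) x (F (x, !p)).1 → (F (x, !p)).1 ∈ R)
    (hg : ∀ x ∈ R, G.Genuine (G.alice x) x (F (x, G.alice x)).1 → (F (x, G.alice x)).1 = g x)
    {W : ℤ} (hW : 0 ≤ W) (hw : ∀ x y, G.Adj x y → |G.w x y| ≤ W)
    (hM : 2 * Fintype.card V * W < M) (start : V × Bool) :
    ∃ i q, 0 < q ∧ F^[q] (F^[i] start) = F^[i] start ∧
      (0 < (if p = true then 1 else -1) *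
          birkhoffSum F ((G.completion s M).cost F) q (F^[i] start) ∨
        ∃ x ∈ R, ∃ m, 0 < m ∧ g^[m] x = x ∧
          birkhoffSum F ((G.completion s M).cost F) q (F^[i] start) =
            birkhoffSum g (G.cost g) m x) := by
  classical
  set ε : ℤ := if p = true then 1 else -1 with hε
  set c := (G.completion s M).cost F with hc
  have hsnd := hF.completion_snd
  have hM0 : 0 < M := lt_of_le_of_lt (by positivity) hM
  have hgen : ∀ v : V × Bool, G.Genuine v.2 v.1 (F v).1 → -W ≤ ε * c v := by
    intro v hv
    have h4 : |c v| ≤ W := by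
      rw [hc, cost_completion_of_genuine hF v hv]
      unfold Genuine at hv
      split_ifs with h5
      · rw [if_pos h5] at hv
        exact hw _ _ hv
      · simpa using hW
    rw [abs_le] at h4
    rw [hε]
    split_ifs <;> linarith
  have hpen : ∀ v : V × Bool, v.2 = p → ¬ G.Genuine v.2 v.1 (F v).1 → (F v).1 = s →
      ε * c v = -M := by
    intro v hv h4 h5
    rw [hc, cost_completion_of_not_genuine hF v h4, h5, hε, penalty, hv]
    cases p <;> simp
  have hpen' : ∀ v : V × Bool, v.2 = !p → ¬ G.Genuine v.2 v.1 (F v).1 →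
      ε * c v = if (F v).1 = s then M else 2 * M := by
    intro v hv h4
    rw [hc, cost_completion_of_not_genuine hF v h4, hε, penalty, hv]
    cases p <;> simp
  -- The potential is the cost of the pending return to `s`. A penalized return of `p` is paid by
  -- its drop, and the `2 * M` of an opponent leaving `R` exceeds its rise by `M`.
  set φ : V × Bool → ℤ := fun v => if v.1 ∈ R then 0 else M with hφ
  have hφM : ∀ v, φ v ≤ M := fun v => by
    simp only [hφ]; split_ifs <;> linarith
  have hbool : ∀ b : Bool, b = p ∨ b = !p := by
    intro b
    cases b <;> cases p <;> simp
  have hstep : ∀ v, φ (F v) - φ v - W ≤ ε * c v := by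
    rintro ⟨x, b⟩
    by_cases hx : x ∈ R
    · have hφx : φ (x, b) = 0 := by simp [hφ, hx]
      by_cases hr : G.Genuine b x (F (x, b)).1
      · have hin : (F (x, b)).1 ∈ R := by
          rcases hbool b with rfl | rfl
          exacts [(h1 x hx).2, h3 x hx hr]
        have hφF : φ (F (x, b)) = 0 := by simp [hφ, hin]
        have := hgen (x, b) hr
        linarith
      · rcases hbool b with rfl | rfl
        · exact absurd (h1 x hx).1 hr
        · have h4 := hpen' (x, !p) rfl hr
          have h5 := hφM (F (x, !p))
          rw [h4]
          split_ifs <;> linarith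
    · have hφx : φ (x, b) = M := by simp [hφ, hx]
      have h5 := hφM (F (x, b))
      by_cases hr : G.Genuine b x (F (x, b)).1
      · have := hgen (x, b) hr
        linarith
      · rcases hbool b with rfl | rfl
        · have h4 := hpen (x, b) rfl hr (h2 x hx)
          have hφF : φ (F (x, b)) = 0 := by simp [hφ, h2 x hx, hs]
          linarith
        · have h4 := hpen' (x, !p) rfl hr
          rw [h4]
          split_ifs <;> linarith
  obtain ⟨i, q, hq, hqc, hcl⟩ := exists_closed F start
  set z := F^[i] start with hz
  -- In `R` only the opponent uses penalized edges. One such step on the cycle makes it good for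
  -- `p`.
  by_cases hbad : ∃ j < q, (F^[j] z).1 ∈ R ∧
      ¬ G.Genuine (F^[j] z).2 (F^[j] z).1 (F (F^[j] z)).1
  · obtain ⟨j, hj, hR, hr⟩ := hbad
    refine ⟨i, q, hq, hcl, Or.inl ?_⟩
    have hpos := birkhoffSum_pos_of_potential (c := fun v => ε * c v) (M := M) φ hW hcl hstep hj
      (by
        rw [iterate_succ_apply']
        set v := F^[j] z
        have hφv : φ v = 0 := by simp [hφ, hR]
        rcases hbool v.2 with hb | hb
        · have := (h1 v.1 hR).1
          rw [← hb] at this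
          exact absurd this hr
        · have h4 := hpen' v hb hr
          simp only [h4]
          split_ifs with h5
          · have hφF : φ (F v) = 0 := by simp [hφ, h5, hs]
            linarith
          · have := hφM (F v)
            linarith)
      (by
        have h4 : (q : ℤ) ≤ 2 * Fintype.card V := by
          rw [Fintype.card_prod, Fintype.card_bool] at hqc
          exact_mod_cast hqc.trans_eq (mul_comm _ _)
        nlinarith)
    rw [show ε * birkhoffSum F c q z = birkhoffSum F (fun v => ε * c v) q z by
      simp [birkhoffSum, Finset.mul_sum]]
    exact hpos
  · have hgood : ∀ j, (F^[j] z).1 ∈ R → G.Genuine (F^[j] z).2 (F^[j] z).1 (F (F^[j] z)).1 := by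
      intro j hR
      by_contra hr
      have hmod : F^[j % q] z = F^[j] z := IsPeriodicPt.iterate_mod_apply (f := F) (x := z) hcl j
      exact hbad ⟨j % q, Nat.mod_lt _ hq, by rwa [hmod], by rwa [hmod]⟩
    -- The players alternate, so `p` moves within two steps, and outside `R` he moves to `s ∈ R`.
    have henter : ∃ j, (F^[j] z).1 ∈ R := by
      by_contra! hno
      rcases hbool z.2 with hb | hb
      · apply hno 1
        have h4 := h2 z.1 (hno 0)
        rw [← hb] at h4
        change (F z).1 ∈ R
        rwa [h4]
      · apply hno 2
        have h4 := h2 (F z).1 (hno 1)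
        have hb' : (F z).2 = p := by rw [hsnd, hb, Bool.not_not]
        rw [← hb'] at h4
        change (F (F z)).1 ∈ R
        rwa [h4]
    obtain ⟨j, hj⟩ := henter
    have hstay : ∀ k, j ≤ k → (F^[k] z).1 ∈ R := by
      intro k hk
      induction k, hk using Nat.le_induction with
      | base => exact hj
      | succ k hk ih =>
        rw [iterate_succ_apply']
        have hr := hgood k ih
        rcases hbool (F^[k] z).2 with hb | hb
        · have := (h1 _ ih).2
          rwa [← hb] at this
        · have := h3 _ ih
          rw [← hb] at this
          exact this hr
    -- At most one forwarding step leads to a copy held by its owner, where the projection to `G`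
    -- can start.
    obtain ⟨k, hjk, x, hx⟩ : ∃ k, j ≤ k ∧ ∃ x, F^[k] z = (x, G.alice x) := by
      by_cases hal : G.alice (F^[j] z).1 = (F^[j] z).2
      · exact ⟨j, le_rfl, _, Prod.ext rfl hal.symm⟩
      · have hr := hgood j hj
        unfold Genuine at hr
        rw [if_neg hal] at hr
        refine ⟨j + 1, by omega, (F^[j] z).1, ?_⟩
        rw [iterate_succ_apply']
        refine Prod.ext hr.symm ?_
        rw [hsnd]
        revert hal
        cases G.alice (F^[j] z).1 <;> cases (F^[j] z).2 <;> simp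
    have hproj : ∀ (y : V) (k : ℕ), j ≤ k → F^[k] z = (y, G.alice y) → ∀ m,
        ∃ l, m ≤ l ∧ F^[l] (y, G.alice y) = (g^[m] y, G.alice (g^[m] y)) ∧
          birkhoffSum F c l (y, G.alice y) = birkhoffSum g (G.cost g) m y := by
      intro y k hk hy
      refine exists_iterate_eq_of_genuine hF ?_ ?_
      · intro l
        rw [← hy, ← iterate_add_apply]
        exact hgood _ (hstay _ (by omega))
      · intro l u hu
        have h4 := hgood (l + k) (hstay _ (by omega))
        have h5 := hstay (l + k) (by omega)
        rw [iterate_add_apply, hy, hu] at h4 h5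
        exact hg u h5 h4
    -- A closed walk of `g` lifts to a closed walk of `F` of the same weight. The lift has length at
    -- least `m`, hence is not empty.
    obtain ⟨a, m, hm, -, ham⟩ := exists_closed g x
    obtain ⟨l, -, hl, -⟩ := hproj x k hjk hx a
    have hlk : F^[l + k] z = (g^[a] x, G.alice (g^[a] x)) := by rw [iterate_add_apply, hx, hl]
    obtain ⟨r, hmr, hr, hsum⟩ := hproj _ (l + k) (by omega) hlk m
    refine ⟨l + k + i, r, by omega, ?_, Or.inr ⟨g^[a] x, ?_, m, hm, ham, ?_⟩⟩
    · rw [iterate_add_apply _ (l + k), ← hz, hlk, hr, ham]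
    · have := hstay (l + k) (by omega)
      rwa [hlk] at this
    · rw [iterate_add_apply _ (l + k), ← hz, hlk, hsum]

end GameGraph

/-! ### Transfer of winning choices between a graph and its completion -/

namespace GameGraph

open Function

variable {V : Type}

/-- If Alice's choices `σ` win from a node, then they win from all its successors. -/
theorem nonnegFrom_succ {G : GameGraph V} {σ : V → V} {x y : V}
    (hx : ∀ f, G.IsChoice f → (∀ u, G.alice u = true → f u = σ u) → NonnegFrom f (G.cost f) x)
    (hadj : G.Adj x y) (hxy : G.alice x = true → σ x = y) (f : V → V) (hf : G.IsChoice f)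
    (hfσ : ∀ u, G.alice u = true → f u = σ u) : NonnegFrom f (G.cost f) y := by
  classical
  intro i q hq hc
  -- If the play from `y` meets `x`, both share their cycle. Otherwise redirecting `f` at `x` to `y`
  -- leaves the play from `y` unchanged and makes it a tail of the play from `x`.
  by_cases hk : ∃ k, f^[k] y = x
  · obtain ⟨k, hk⟩ := hk
    have hxi : f^[i] x = f^[k] (f^[i] y) := by
      rw [← hk, ← iterate_add_apply, ← iterate_add_apply, add_comm]
    have h := hx f hf hfσ i q hq (by rw [hxi]; exact iterate_closed hc k)
    rwa [hxi, birkhoffSum_iterate_of_closed hc] at h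
  · set f' := update f x y with hf'
    have heq : ∀ j, f'^[j] y = f^[j] y := by
      intro j
      induction j with
      | zero => rfl
      | succ j ih =>
        rw [iterate_succ_apply', iterate_succ_apply', ih, hf', update_of_ne]
        exact fun h => hk ⟨j, h⟩
    have hsucc : ∀ j, f'^[j + 1] x = f^[j] y := by
      intro j
      rw [iterate_succ_apply, hf', update_self, ← hf', heq]
    have h := hx f' (fun u => ?_) (fun u hu => ?_) (i + 1) q hq ?_
    · rw [hsucc] at h
      convert h using 1
      unfold birkhoffSum
      refine Finset.sum_congr rfl fun j _ => ?_
      have h1 : f'^[j] (f^[i] y) = f^[j] (f^[i] y) := by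
        rw [← heq i, ← iterate_add_apply, heq, heq, ← iterate_add_apply]
      have h2 : f' (f^[j] (f^[i] y)) = f (f^[j] (f^[i] y)) := by
        rw [hf', update_of_ne]
        rw [← iterate_add_apply]
        exact fun h => hk ⟨_, h⟩
      rw [h1, cost, cost, h2]
    · by_cases hux : u = x
      · subst hux; rw [hf', update_self]; exact hadj
      · rw [hf', update_of_ne hux]; exact hf u
    · by_cases hux : u = x
      · subst hux; rw [hf', update_self]; exact (hxy hu).symm
      · rw [hf', update_of_ne hux]; exact hfσ u hu
    · rw [hsucc, ← heq i, ← iterate_add_apply, heq, heq, iterate_add_apply, hc]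

section Completion

variable [Fintype V] [DecidableEq V] {G : GameGraph V} {s : V} {M W : ℤ}

theorem AliceWins.completion (hW : 0 ≤ W) (hw : ∀ x y, G.Adj x y → |G.w x y| ≤ W)
    (hM : 2 * Fintype.card V * W < M) (h : G.AliceWins s) :
    (G.completion s M).AliceWins (s, true) := by
  classical
  obtain ⟨σ, hσ, hwin⟩ := h
  set R : Set V := {x | ∀ f, G.IsChoice f → (∀ u, G.alice u = true → f u = σ u) →
    NonnegFrom f (G.cost f) x} with hR
  set σ' : V × Bool → V × Bool := fun v =>
    (if v.2 = true ∧ v.1 ∈ R then if G.alice v.1 = true then σ v.1 else v.1 else s, !v.2) with hσ'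
  refine ⟨σ', fun v => by simp [hσ', Adj, GameGraph.completion], fun F hF hFσ => ?_⟩
  have hFA : ∀ x, F (x, true) = σ' (x, true) := fun x => hFσ _ rfl
  -- The choice in `G` induced by `F`. Where Bob's move is not an edge of `G`, the value `σ x` is a
  -- mere default.
  set g : V → V := fun x => if G.alice x = true then σ x else
    if G.Adj x (F (x, false)).1 then (F (x, false)).1 else σ x with hg
  have hgc : G.IsChoice g := by
    intro x
    simp only [hg]
    split_ifs with h1 h2
    exacts [hσ x, h2, hσ x]
  have hgσ : ∀ u, G.alice u = true → g u = σ u := fun u hu => by simp [hg, hu]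
  obtain ⟨i, q, hq, hcl, hgood⟩ := exists_closed_completion (g := g) hF true R hwin
    (fun x hx => by
      rw [hFA]
      simp only [hσ', hx, and_self, if_true, Genuine]
      split_ifs with h1
      · exact ⟨hσ x, nonnegFrom_succ hx (hσ x) fun _ => rfl⟩
      · exact ⟨rfl, hx⟩)
    (fun x hx => by rw [hFA]; simp [hσ', hx])
    (fun x hx hr => by
      unfold Genuine at hr
      split_ifs at hr with h1
      · exact nonnegFrom_succ hx hr fun h2 => by simp [h1] at h2
      · rw [Bool.not_true] at hr ⊢
        rwa [← hr])
    (fun x hx hr => by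
      unfold Genuine at hr
      rw [if_pos rfl] at hr
      by_cases h1 : G.alice x = true
      · rw [h1, hFA]
        simp [hσ', hx, hg, h1]
      · rw [Bool.not_eq_true] at h1
        rw [h1] at hr ⊢
        simp [hg, h1, hr])
    hW hw hM (s, true)
  rw [nonnegFrom_iff_of_closed hq hcl]
  rcases hgood with h1 | ⟨x, hx, m, hm, hxm, hsum⟩
  · simp only [if_true, one_mul] at h1
    exact h1.le
  · rw [hsum]
    exact hx g hgc hgσ 0 m hm hxm

theorem AliceWins.of_completion (hW : 0 ≤ W) (hw : ∀ x y, G.Adj x y → |G.w x y| ≤ W)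
    (hM : 2 * Fintype.card V * W < M) (h : (G.completion s M).AliceWins (s, true)) :
    G.AliceWins s := by
  classical
  obtain ⟨σ', hσ', hwin⟩ := h
  obtain ⟨d, hd⟩ := G.exists_isChoice
  by_contra hno
  unfold AliceWins at hno
  push Not at hno
  obtain ⟨f, hf, hfσ, hneg⟩ := hno
    -- Alice's choice in `G` read off from `σ'`, with default `d` where `σ'` takes a penalized edge.
    -- Bob's answer `f` beats it from `s`.
    (fun x => if G.Adj x (σ' (x, true)).1 then (σ' (x, true)).1 else d x) (by
      intro x
      dsimp only
      split_ifs with h1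
      exacts [h1, hd x])
  set R : Set V := {x | ∃ i, f^[i] s = x} with hR
  have hRf : ∀ x ∈ R, f x ∈ R := by
    rintro x ⟨i, rfl⟩
    exact ⟨i + 1, iterate_succ_apply' _ _ _⟩
  set F : V × Bool → V × Bool := fun v => if v.2 = true then σ' v else
    (if v.1 ∈ R then if G.alice v.1 = false then f v.1 else v.1 else s, true) with hF
  have hFc : (G.completion s M).IsChoice F := by
    rintro ⟨x, b⟩
    cases b
    · simp [hF, Adj, GameGraph.completion]
    · simpa [hF] using hσ' (x, true)
  have hFA : ∀ x, F (x, true) = σ' (x, true) := fun x => by simp [hF]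
  have halice : ∀ x, G.alice x = true → G.Adj x (F (x, true)).1 → (F (x, true)).1 = f x := by
    intro x h1 h2
    rw [hFA] at h2 ⊢
    rw [hfσ x h1, if_pos h2]
  obtain ⟨i, q, hq, hcl, hgood⟩ := exists_closed_completion (g := f) hFc false R ⟨0, rfl⟩
    (fun x hx => by
      simp only [hF, hx, Genuine, Bool.false_eq_true, if_false, if_true]
      split_ifs with h1
      · exact ⟨hf x, hRf x hx⟩
      · exact ⟨rfl, hx⟩)
    (fun x hx => by simp [hF, hx])
    (fun x hx hr => by
      unfold Genuine at hr
      rw [Bool.not_false] at hr ⊢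
      split_ifs at hr with h1
      · rw [halice x h1 hr]
        exact hRf x hx
      · rwa [← hr])
    (fun x hx hr => by
      unfold Genuine at hr
      rw [if_pos rfl] at hr
      by_cases h1 : G.alice x = true
      · rw [h1] at hr ⊢
        exact halice x h1 hr
      · rw [Bool.not_eq_true] at h1
        simp [hF, hx, h1])
    hW hw hM (s, true)
  have hpos := hwin F hFc (fun u hu => by
    obtain ⟨x, b⟩ := u
    obtain rfl : b = true := hu
    exact hFA x) i q hq hcl
  rcases hgood with h1 | ⟨x, ⟨j, rfl⟩, m, hm, hxm, hsum⟩
  -- A walk good for Bob has negative weight, contrary to `hpos`.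
  · simp at h1
    linarith
  -- The projected walk lies on the play of `f` from `s`, so its nonnegative weight would make all
  -- closed walks on that play nonnegative.
  · rw [hsum] at hpos
    exact hneg ((nonnegFrom_iff_of_closed hm hxm).mpr hpos)

end Completion

/-- Rename the nodes of a game graph. -/
def relabel {U : Type} (G : GameGraph U) (e : V ≃ U) : GameGraph V where
  alice x := G.alice (e x)
  weight x y := G.weight (e x) (e y)
  exists_edge x := by
    obtain ⟨y, hy⟩ := G.exists_edge (e x)
    exact ⟨e.symm y, by simpa using hy⟩

theorem AliceWins.relabel {U : Type} {G : GameGraph U} {u : U} (h : G.AliceWins u) (e : V ≃ U) :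
    (G.relabel e).AliceWins (e.symm u) := by
  obtain ⟨σ, hσ, hwin⟩ := h
  refine ⟨fun x => e.symm (σ (e x)), fun x => by simpa [GameGraph.relabel, Adj] using hσ (e x),
    fun f hf hfσ i q hq hc => ?_⟩
  set f' : U → U := fun y => e (f (e.symm y)) with hf'
  have hsemi : Semiconj e f f' := fun x => by simp [hf']
  have hi : f'^[i] u = e (f^[i] (e.symm u)) := by
    rw [(hsemi.iterate_right i).eq, e.apply_symm_apply]
  have h := hwin f' (fun y => ?_) (fun y hy => ?_) i q hq ?_
  · convert h using 1
    unfold birkhoffSum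
    refine Finset.sum_congr rfl fun j _ => ?_
    rw [hi, ← (hsemi.iterate_right j).eq, cost, cost, ← hsemi.eq]
    rfl
  · simpa [GameGraph.relabel, Adj] using hf (e.symm y)
  · simp only [hf']
    rw [hfσ _ (by simpa [GameGraph.relabel] using hy)]
    simp
  · rw [hi, ← (hsemi.iterate_right q).eq, hc]

theorem relabel_relabel_symm {U : Type} (G : GameGraph U) (e : V ≃ U) :
    (G.relabel e).relabel e.symm = G := by
  simp [GameGraph.relabel]

theorem aliceWins_relabel_iff {U : Type} {G : GameGraph U} (e : V ≃ U) (x : V) :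
    (G.relabel e).AliceWins x ↔ G.AliceWins (e x) := by
  constructor
  · intro h
    have := h.relabel e.symm
    rwa [relabel_relabel_symm] at this
  · intro h
    simpa using h.relabel e

end GameGraph

/-! ### Structured stack programs and their Turing machines -/

/-- Structured programs on a family of stacks. `loop k body again` pops a symbol `o` from the stack
`k` (`none` if it is empty), runs `body o`, and repeats this as long as `again o`. -/
inductive StackProg (K A : Type) : Type
  | skip : StackProg K A
  | push (k : K) (a : A) : StackProg K A
  | seq (p q : StackProg K A) : StackProg K A
  | loop (k : K) (body : Option A → StackProg K A) (again : Option A → Bool) : StackProg K A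

namespace StackProg

open Function Turing

variable {K A : Type}

/-- The labels of the Turing machine of a program. -/
inductive Label : StackProg K A → Type
  | skip : Label skip
  | push (k a) : Label (push k a)
  | left {p q} (l : Label p) : Label (seq p q)
  | right {p q} (l : Label q) : Label (seq p q)
  | head (k body again) : Label (loop k body again)
  | body {k body again} (o : Option A) (l : Label (body o)) : Label (loop k body again)

theorem finite_label [Finite A] (p : StackProg K A) : Finite (Label p) := by
  induction p with
  | skip => exact Finite.of_surjective (fun _ : Unit => Label.skip) (by rintro ⟨⟩; exact ⟨(), rfl⟩)
  | push k a =>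
    exact Finite.of_surjective (fun _ : Unit => Label.push k a) (by rintro ⟨⟩; exact ⟨(), rfl⟩)
  | seq p q ihp ihq =>
    refine Finite.of_surjective (Sum.elim (Label.left (q := q)) (Label.right (p := p))) ?_
    rintro (_ | _)
    exacts [⟨.inl _, rfl⟩, ⟨.inr _, rfl⟩]
  | loop k body again ih =>
    refine Finite.of_surjective (fun x : Option (Σ o, Label (body o)) =>
      (x.elim (Label.head k body again) fun y => Label.body y.1 y.2)) ?_
    rintro (_ | _)
    exacts [⟨none, rfl⟩, ⟨some ⟨_, _⟩, rfl⟩]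

/-- The label at which a program starts. -/
def entry : (p : StackProg K A) → Label p
  | skip => .skip
  | push k a => .push k a
  | seq p _ => .left (entry p)
  | loop k body again => .head k body again

/-- The statements of a program whose labels are embedded by `ι`, and that continues at `exit`. -/
def code {Λ : Type} : (p : StackProg K A) → (Label p → Λ) → Λ → Label p →
    TM2.Stmt (fun _ : K => A) Λ (Option A)
  | skip, _, exit, _ => .goto fun _ => exit
  | push k a, _, exit, _ => .push k (fun _ => a) (.goto fun _ => exit)
  | seq p q, ι, _, .left l => code p (fun l => ι (.left l)) (ι (.right (entry q))) l
  | seq _ q, ι, exit, .right l => code q (fun l => ι (.right l)) exit l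
  -- The popped symbol becomes the internal state, by which the jump selects the copy of the body
  -- for this symbol.
  | loop k body _, ι, _, .head _ _ _ =>
    .pop k (fun _ o => o) (.goto fun o => ι (.body o (entry (body o))))
  | loop _ body again, ι, exit, .body o l =>
    code (body o) (fun l => ι (.body o l)) (bif again o then ι (.head _ _ _) else exit) l

variable [DecidableEq K]

/-- `Exec p S T t`: started on the stacks `S`, the program `p` stops with the stacks `T` after at
most `t` steps. -/
inductive Exec : StackProg K A → (K → List A) → (K → List A) → ℕ → Prop
  | skip (S) : Exec skip S S 1
  | push (k a S) : Exec (push k a) S (update S k (a :: S k)) 1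
  | seq {p q S T U t u} : Exec p S T t → Exec q T U u → Exec (seq p q) S U (t + u)
  | last {k body again S T t} : again (S k).head? = false →
      Exec (body (S k).head?) (update S k (S k).tail) T t → Exec (loop k body again) S T (t + 1)
  | again {k body again S T U t u} : again (S k).head? = true →
      Exec (body (S k).head?) (update S k (S k).tail) T t → Exec (loop k body again) T U u →
      Exec (loop k body again) S U (t + 1 + u)
  | mono {p S T t u} : Exec p S T t → t ≤ u → Exec p S T u

/-- The induction needs an arbitrary surrounding machine, since a subprogram occupies only part of
the labels and has its own exit. The internal state is arbitrary because each loop reloads it before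
use. -/
theorem Exec.iterate_step {p : StackProg K A} {S T : K → List A} {t : ℕ} (h : Exec p S T t) :
    ∀ {Λ : Type} (m : Λ → TM2.Stmt (fun _ : K => A) Λ (Option A)) (ι : Label p → Λ) (exit : Λ),
      (∀ l, m (ι l) = code p ι exit l) → ∀ v, ∃ v' j, j ≤ t ∧
        (flip bind (TM2.step m))^[j] (some ⟨some (ι (entry p)), v, S⟩) =
          some ⟨some exit, v', T⟩ := by
  induction h with
  | skip S =>
    intro Λ m ι exit hm v
    refine ⟨v, 1, le_rfl, ?_⟩
    simp [flip, TM2.step, hm, code]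
  | push k a S =>
    intro Λ m ι exit hm v
    refine ⟨v, 1, le_rfl, ?_⟩
    simp [flip, TM2.step, hm, code]
  | @seq p q S T U t u _ _ ih1 ih2 =>
    intro Λ m ι exit hm v
    obtain ⟨v1, j1, hj1, h1⟩ := ih1 m (fun l => ι (.left l)) (ι (.right (entry q)))
      (fun l => by rw [hm]; rfl) v
    obtain ⟨v2, j2, hj2, h2⟩ := ih2 m (fun l => ι (.right l)) exit (fun l => by rw [hm]; rfl) v1
    refine ⟨v2, j2 + j1, by omega, ?_⟩
    rw [iterate_add_apply]
    exact (congrArg _ h1).trans h2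
  | @last k body again S T t ha _ ih =>
    intro Λ m ι exit hm v
    obtain ⟨v1, j1, hj1, h1⟩ := ih m (fun l => ι (.body _ l)) exit
      (fun l => by rw [hm, code, ha]; rfl) (S k).head?
    refine ⟨v1, j1 + 1, by omega, ?_⟩
    rw [iterate_succ_apply, ← h1]
    simp [flip, TM2.step, hm, code, entry]
  | @again k body again S T U t u ha _ _ ih1 ih2 =>
    intro Λ m ι exit hm v
    obtain ⟨v1, j1, hj1, h1⟩ := ih1 m (fun l => ι (.body _ l)) (ι (.head _ _ _))
      (fun l => by rw [hm, code, ha]; rfl) (S k).head?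
    obtain ⟨v2, j2, hj2, h2⟩ := ih2 m ι exit hm v1
    refine ⟨v2, j2 + (j1 + 1), by omega, ?_⟩
    rw [iterate_add_apply, iterate_succ_apply]
    refine (congrArg _ (Eq.trans ?_ h1)).trans h2
    simp [flip, TM2.step, hm, code, entry]
  | mono _ htu ih =>
    intro Λ m ι exit hm v
    obtain ⟨v1, j, hj, h1⟩ := ih m ι exit hm v
    exact ⟨v1, j, hj.trans htu, h1⟩

/-- The Turing machine of a program, with input and output on the stack `k`. -/
noncomputable def machine [Fintype K] [Fintype A] (p : StackProg K A) (k : K) : FinTM2 where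
  K := K
  k₀ := k
  k₁ := k
  Γ _ := A
  Λ := Option (Label p)
  main := some (entry p)
  ΛFin := have := finite_label p; Fintype.ofFinite _
  σ := Option A
  initialState := none
  Γk₀Fin := inferInstanceAs (Fintype A)
  m
    -- The prescribed final configuration has the initial internal state, hence this reset, which
    -- costs one extra step.
    | none => .load (fun _ => none) .halt
    | some l => code p some none l

/-- A function is computable in polynomial time if a program computes it on the stack `k` and
empties all other stacks. -/
theorem computableInPolyTime [Fintype K] [Fintype A] {α β : Type} {ea : α → List A}
    {eb : β → List A} {f : α → β} (p : StackProg K A) (k : K) (time : Polynomial ℕ)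
    (h : ∀ a, Exec p (update (fun _ => []) k (ea a)) (update (fun _ => []) k (eb (f a)))
      (time.eval (ea a).length)) : Nonempty (TM2ComputableInPolyTime ea eb f) := by
  have hinit : ∀ l : List A, initList (machine p k) l =
      ⟨some (some (entry p)), none, update (fun _ => []) k l⟩ := by
    intro l
    unfold initList
    congr 1
    funext k'
    by_cases hk : k' = k
    · exact (dif_pos hk).trans
        ((update_apply (fun _ => ([] : List A)) k l k').trans (if_pos hk)).symm
    · exact (dif_neg hk).trans
        ((update_apply (fun _ => ([] : List A)) k l k').trans (if_neg hk)).symm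
  have hhalt : ∀ l : List A, haltList (machine p k) l =
      ⟨none, none, update (fun _ => []) k l⟩ := by
    intro l
    unfold haltList
    congr 1
    funext k'
    by_cases hk : k' = k
    · exact (dif_pos hk).trans
        ((update_apply (fun _ => ([] : List A)) k l k').trans (if_pos hk)).symm
    · exact (dif_neg hk).trans
        ((update_apply (fun _ => ([] : List A)) k l k').trans (if_neg hk)).symm
  have hmap : ∀ l : List A, l.map (Equiv.refl A).invFun = l := fun l => List.map_id l
  have hrun : ∀ a, ∃ j ≤ time.eval (ea a).length + 1,
      (flip bind (machine p k).step)^[j]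
        (some (initList (machine p k) ((ea a).map (Equiv.refl A).invFun))) =
        some (haltList (machine p k) ((eb (f a)).map (Equiv.refl A).invFun)) := by
    intro a
    obtain ⟨v, j, hj, hv⟩ := (h a).iterate_step (machine p k).m some none (fun l => rfl) none
    refine ⟨1 + j, by omega, ?_⟩
    have h1 := (hinit _).trans (congrArg (fun l : List A => (⟨some (some (entry p)), none,
      update (fun _ => []) k l⟩ : (machine p k).Cfg)) (hmap (ea a)))
    have h2 := (hhalt _).trans (congrArg (fun l : List A => (⟨none, none,
      update (fun _ => []) k l⟩ : (machine p k).Cfg)) (hmap (eb (f a))))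
    refine (congrArg (fun x => (flip bind (machine p k).step)^[1 + j] (some x)) h1).trans
      (Eq.trans ?_ (congrArg some h2).symm)
    refine (iterate_add_apply _ _ _ _).trans ((congrArg _ hv).trans ?_)
    rfl
  exact ⟨{
    tm := machine p k
    inputAlphabet := Equiv.refl A
    outputAlphabet := Equiv.refl A
    time := time + 1
    outputsFun := fun a => {
      steps := (hrun a).choose
      evals_in_steps := (hrun a).choose_spec.2
      steps_le_m := by simpa using (hrun a).choose_spec.1 } }⟩

/-- Push the symbols of `l` one after the other. -/
def pushList (k : K) : List A → StackProg K A
  | [] => skip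
  | a :: l => seq (push k a) (pushList k l)

theorem Exec.pushList (k : K) (l : List A) (S : K → List A) :
    Exec (pushList k l) S (update S k (l.reverse ++ S k)) (l.length + 1) := by
  induction l generalizing S with
  | nil => simpa using! Exec.skip S
  | cons a l ih =>
    have h := ((Exec.push k a S).seq (ih _)).mono
      (u := (a :: l).length + 1) (by rw [List.length_cons]; omega)
    simpa using! h

/-- Move the stack `a` to the stack `b`, in reverse order. -/
def pour (a b : K) : StackProg K A :=
  loop a (fun o => match o with
    | some x => push b x
    | none => skip) Option.isSome

theorem Exec.pour {a b : K} (hab : a ≠ b) (S : K → List A) :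
    Exec (pour a b) S (update (update S a []) b ((S a).reverse ++ S b)) (2 * (S a).length + 2) := by
  suffices h : ∀ (l : List A) (S : K → List A), S a = l →
      Exec (StackProg.pour a b) S (update (update S a []) b (l.reverse ++ S b))
        (2 * l.length + 2) from h _ _ rfl
  intro l
  induction l with
  | nil =>
    intro S hS
    refine Exec.last (t := 1) (by simp [hS]) ?_
    simp only [hS, List.head?_nil, List.tail_nil, List.reverse_nil, List.nil_append]
    rw [← update_of_ne hab.symm [] S, update_eq_self]
    exact Exec.skip _
  | cons x l ih =>
    intro S hS
    have h1 := ih (update (update S a l) b (x :: S b)) (by simp [update_of_ne hab])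
    suffices h : update (update S a []) b ((x :: l).reverse ++ S b) =
        update (update (update (update S a l) b (x :: S b)) a []) b
          (l.reverse ++ update (update S a l) b (x :: S b) b) by
      rw [h]
      refine (Exec.again (t := 1) (by simp [hS]) ?_ h1).mono (by simp; omega)
      simp only [hS, List.head?_cons, List.tail_cons]
      have := Exec.push b x (update S a l)
      rwa [update_of_ne hab.symm] at this
    · funext k
      by_cases hkb : k = b
      · subst hkb; simp
      · by_cases hka : k = a
        · subst hka; simp [hab]
        · simp [hkb, hka]

/-- Empty the stack `a`. -/
def clear (a : K) : StackProg K A := loop a (fun _ => skip) Option.isSome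

theorem Exec.clear (a : K) (S : K → List A) :
    Exec (clear a) S (update S a []) (2 * (S a).length + 2) := by
  suffices h : ∀ (l : List A) (S : K → List A), S a = l →
      Exec (StackProg.clear a) S (update S a []) (2 * l.length + 2) from h _ _ rfl
  intro l
  induction l with
  | nil =>
    intro S hS
    refine Exec.last (t := 1) (by simp [hS]) ?_
    simp only [hS, List.tail_nil]
    exact Exec.skip _
  | cons x l ih =>
    intro S hS
    have h1 := ih (update S a l) (by simp)
    rw [update_idem] at h1
    refine (Exec.again (t := 1) (by simp [hS]) ?_ h1).mono (by simp; omega)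
    simp only [hS, List.tail_cons]
    exact Exec.skip _

theorem Exec.congr {p : StackProg K A} {S T T' : K → List A} {t t' : ℕ} (h : Exec p S T t)
    (hT : T = T') (ht : t ≤ t') : Exec p S T' t' := by
  subst hT
  exact h.mono ht

theorem Exec.again_cons {k : K} {body : Option A → StackProg K A} {again : Option A → Bool} {a : A}
    {l : List A} {S S' T U : K → List A} {t u : ℕ} (hS : S k = a :: l)
    (hS' : Function.update S k l = S') (ha : again (some a) = true)
    (hb : Exec (body (some a)) S' T t) (hl : Exec (loop k body again) T U u) :
    Exec (loop k body again) S U (t + 1 + u) :=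
  .again (by simpa [hS] using ha) (by simpa [hS, hS'] using hb) hl

theorem Exec.last_cons {k : K} {body : Option A → StackProg K A} {again : Option A → Bool} {a : A}
    {l : List A} {S S' T : K → List A} {t : ℕ} (hS : S k = a :: l)
    (hS' : Function.update S k l = S') (ha : again (some a) = false)
    (hb : Exec (body (some a)) S' T t) : Exec (loop k body again) S T (t + 1) :=
  .last (by simpa [hS] using ha) (by simpa [hS, hS'] using hb)

theorem Exec.last_nil {k : K} {body : Option A → StackProg K A} {again : Option A → Bool}
    {S T : K → List A} {t : ℕ} (hS : S k = []) (ha : again none = false)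
    (hb : Exec (body none) S T t) : Exec (loop k body again) S T (t + 1) := by
  refine .last (by simpa [hS] using ha) ?_
  have : Function.update S k [] = S := by rw [← hS, Function.update_eq_self]
  simpa [hS, this] using hb

end StackProg

/-! ### The program of the reduction -/

namespace EnergyReduction

open StackProg Computability EnergyInstance

/-- The stacks of the reduction: the input, the output, the owners of the remaining nodes, the marks
of the start node, the position of the current row, and a word that is as long as the input. The
symbols read from the last three are kept on another stack each. -/
inductive Stack
  | inp | out | own | start | startDone | pos | posDone | len | lenDone
  deriving DecidableEq

instance : Fintype Stack :=
  ⟨{.inp, .out, .own, .start, .startDone, .pos, .posDone, .len, .lenDone},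
    fun x => by cases x <;> decide⟩

abbrev Prog := StackProg Stack Γ'

/-- The stacks with the given contents. -/
def store (inp out own start startDone pos posDone len lenDone : List Γ') : Stack → List Γ'
  | .inp => inp
  | .out => out
  | .own => own
  | .start => start
  | .startDone => startDone
  | .pos => pos
  | .posDone => posDone
  | .len => len
  | .lenDone => lenDone

/-- The word for a penalty with `L + 1` or `L + 2` binary digits. -/
def penaltyWord (p atStart : Bool) (L : ℕ) : List Γ' :=
  [Γ'.bra, Γ'.bit p] ++ List.replicate L (Γ'.bit false) ++
    if atStart then [Γ'.bit true, Γ'.ket] else [Γ'.bit false, Γ'.bit true, Γ'.ket]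

def pushZeros : Prog :=
  loop .len (fun o => match o with
    | some x => seq (push .lenDone x) (push .out (Γ'.bit false))
    | none => skip) Option.isSome

theorem exec_pushZeros (l i o ow s sd ps pd ld : List Γ') :
    Exec pushZeros (store i o ow s sd ps pd l ld)
      (store i (List.replicate l.length (Γ'.bit false) ++ o) ow s sd ps pd [] (l.reverse ++ ld))
      (3 * l.length + 2) := by
  induction l generalizing o ld with
  | nil => exact Exec.last_nil rfl rfl (Exec.skip _)
  | cons a l ih =>
    refine Exec.congr (Exec.again_cons (a := a) (l := l) rfl rfl rfl
      ((Exec.push _ _ _).seq (Exec.congr (Exec.push _ _ _) ?_ le_rfl))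
      (ih (Γ'.bit false :: o) (a :: ld))) ?_ (by rw [List.length_cons]; omega)
    · funext k; cases k <;> simp [store]
    · funext k; cases k <;> simp [store, List.replicate_succ']

/-- Output the penalty of the player `p` for an edge to the start node or to another node. -/
def pushPenalty (p atStart : Bool) : Prog :=
  seq (pushList .out [Γ'.bra, Γ'.bit p]) <| seq pushZeros <|
    seq (pushList .out (if atStart then [Γ'.bit true, Γ'.ket]
      else [Γ'.bit false, Γ'.bit true, Γ'.ket])) <|
      pour .lenDone .len

theorem exec_pushPenalty (p b : Bool) (l i o ow s sd ps pd : List Γ') :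
    Exec (pushPenalty p b) (store i o ow s sd ps pd l [])
      (store i ((penaltyWord p b l.length).reverse ++ o) ow s sd ps pd l [])
      (5 * l.length + 11) := by
  refine Exec.congr ((Exec.congr (Exec.pushList _ _ _) ?_ le_rfl).seq
    ((exec_pushZeros l i (Γ'.bit p :: Γ'.bra :: o) ow s sd ps pd []).seq
    ((Exec.pushList _ _ _).seq (Exec.pour (by decide) _)))) ?_ ?_
  · funext k; cases k <;> simp [store]
  · funext k; cases k <;> simp [store, penaltyWord]
  · cases b <;> simp [store] <;> omega

/-- Copy an entry of the weight matrix, or output a penalty for a missing one. -/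
def copyEntry (p atStart : Bool) : Prog :=
  loop .inp (fun o => match o with
    | some Γ'.blank => pushPenalty p atStart
    | some a => push .out a
    | none => skip) (fun o => match o with
    | some Γ'.bra => true
    | some (Γ'.bit _) => true
    | _ => false)

/-- The output for an entry of the weight matrix. -/
def entryWord (p atStart : Bool) (L : ℕ) (e : Option ℤ) : List Γ' :=
  if e = none then penaltyWord p atStart L else encodeEntry e

theorem exec_copyEntry_bits (p b : Bool) (bits : List Bool) (i o ow s sd ps pd l : List Γ') :
    Exec (copyEntry p b) (store (bits.map Γ'.bit ++ Γ'.ket :: i) o ow s sd ps pd l [])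
      (store i (Γ'.ket :: (bits.map Γ'.bit).reverse ++ o) ow s sd ps pd l [])
      (2 * bits.length + 2) := by
  induction bits generalizing o with
  | nil =>
    refine Exec.congr (Exec.last_cons (a := Γ'.ket) (l := i) rfl rfl rfl (Exec.push _ _ _))
      ?_ le_rfl
    funext k; cases k <;> simp [store]
  | cons a bits ih =>
    refine Exec.congr (Exec.again_cons (a := Γ'.bit a)
      (l := bits.map Γ'.bit ++ Γ'.ket :: i) rfl rfl rfl
      (Exec.congr (Exec.push _ _ _) ?_ le_rfl) (ih (Γ'.bit a :: o))) ?_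
        (by rw [List.length_cons]; omega)
    · funext k; cases k <;> simp [store]
    · funext k; cases k <;> simp [store]

theorem exec_copyEntry (p b : Bool) (e : Option ℤ) (i o ow s sd ps pd l : List Γ') :
    Exec (copyEntry p b) (store (encodeEntry e ++ i) o ow s sd ps pd l [])
      (store i ((entryWord p b l.length e).reverse ++ o) ow s sd ps pd l [])
      (2 * (encodeEntry e).length + 5 * l.length + 12) := by
  cases e with
  | none =>
    refine Exec.congr (Exec.last_cons (a := Γ'.blank) (l := i) rfl ?_ rfl
      (exec_pushPenalty p b l i o ow s sd ps pd)) rfl (by omega)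
    funext k; cases k <;> simp [store]
  | some z =>
    refine Exec.congr (Exec.again_cons (a := Γ'.bra) rfl rfl rfl
      (Exec.congr (Exec.push _ _ _) ?_ le_rfl)
      (exec_copyEntry_bits p b (decide (z < 0) :: encodeNat z.natAbs) i (Γ'.bra :: o)
        ow s sd ps pd l)) ?_ ?_
    · funext k; cases k <;> simp [store]
    · funext k; cases k <;> simp [store, entryWord, encodeEntry]
    · simp [encodeEntry]; omega

/-- Output a zero on the diagonal and a penalty elsewhere. -/
def forwardEntry (p atStart : Bool) : Prog :=
  loop .pos (fun o => match o with
    | some Γ'.comma => seq (push .posDone Γ'.comma) (pushList .out [Γ'.bra, Γ'.bit false, Γ'.ket])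
    | some a => seq (push .posDone a) (pushPenalty p atStart)
    | none => skip) (fun _ => false)

/-- The output for an entry of a row of a forwarding node. -/
def forwardWord (p atStart : Bool) (L : ℕ) (a : Γ') : List Γ' :=
  if a = Γ'.comma then [Γ'.bra, Γ'.bit false, Γ'.ket] else penaltyWord p atStart L

theorem exec_forwardEntry (p b : Bool) (a : Γ') (i o ow s sd ps pd l : List Γ') :
    Exec (forwardEntry p b) (store i o ow s sd (a :: ps) pd l [])
      (store i ((forwardWord p b l.length a).reverse ++ o) ow s sd ps (a :: pd) l [])
      (5 * l.length + 13) := by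
  by_cases ha : a = Γ'.comma
  · subst ha
    refine Exec.congr (Exec.last_cons (a := Γ'.comma) (l := ps) rfl rfl rfl
      ((Exec.push _ _ _).seq (Exec.pushList _ _ _))) ?_ (by simp)
    funext k; cases k <;> simp [store, forwardWord]
  · have hb : (match some a with
      | some Γ'.comma => seq (push Stack.posDone Γ'.comma)
          (pushList Stack.out [Γ'.bra, Γ'.bit false, Γ'.ket])
      | some a => seq (push Stack.posDone a) (pushPenalty p b)
      | none => skip) = seq (push Stack.posDone a) (pushPenalty p b) := by
      cases a <;> simp_all
    refine Exec.congr (Exec.last_cons (a := a) (l := ps) rfl rfl rfl (hb ▸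
      (Exec.congr (Exec.push _ _ _) ?_ le_rfl).seq
        (exec_pushPenalty p b l i o ow s sd ps (a :: pd)))) ?_ (by omega)
    all_goals funext k; cases k <;> simp [store, forwardWord, ha]

/-- Go through the nodes `u` and output the two entries of a row of the player `p` at the copies of
`u`, one of which is missing. -/
def rowLoop (p : Bool) (cell : Bool → Prog) : Prog :=
  loop .start (fun o => match o with
    | some (Γ'.bit b) => seq (push .startDone (Γ'.bit b))
        (if p then seq (push .out Γ'.blank) (cell b) else seq (cell b) (push .out Γ'.blank))
    | _ => skip) Option.isSome

/-- The two entries of a row of the player `p` at the copies of a node. -/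
def pairWord (p : Bool) (w : List Γ') : List Γ' := if p then Γ'.blank :: w else w ++ [Γ'.blank]

/-- At the node `u`, a cell consumes `f u` from the input and `g u` from the position stack, and
outputs `h u`. This covers both kinds of rows: copied rows have `g` empty, forwarding rows have `f`
empty. -/
theorem exec_rowLoop {ι : Type} (p : Bool) (cell : Bool → Prog) (T : ℕ) (b : ι → Bool)
    (f g h : ι → List Γ') (us : List ι) (ow l : List Γ')
    (hcell : ∀ u ∈ us, ∀ i o s sd ps pd,
      Exec (cell (b u)) (store (f u ++ i) o ow s sd (g u ++ ps) pd l [])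
        (store i ((h u).reverse ++ o) ow s sd ps ((g u).reverse ++ pd) l []) T)
    (i o sd ps pd : List Γ') :
    Exec (rowLoop p cell)
      (store (us.flatMap f ++ i) o ow (us.map fun u => Γ'.bit (b u)) sd
        (us.flatMap g ++ ps) pd l [])
      (store i ((us.flatMap fun u => pairWord p (h u)).reverse ++ o) ow []
        ((us.map fun u => Γ'.bit (b u)).reverse ++ sd) ps ((us.flatMap g).reverse ++ pd) l [])
      ((T + 3) * us.length + 2) := by
  induction us generalizing o sd pd with
  | nil => exact Exec.last_nil rfl rfl (Exec.skip _)
  | cons u us ih =>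
    have h1 := ih (fun u hu => hcell u (by simp [hu])) ((pairWord p (h u)).reverse ++ o)
      (Γ'.bit (b u) :: sd) ((g u).reverse ++ pd)
    have h2 := hcell u (by simp) (us.flatMap f ++ i)
    refine Exec.congr (Exec.again_cons (a := Γ'.bit (b u))
      (l := us.map fun u => Γ'.bit (b u)) rfl rfl rfl
      (t := T + 2) ?_ h1) ?_ ?_
    · cases p
      · refine Exec.congr ((Exec.congr (Exec.push _ _ _) ?_ le_rfl).seq
          ((h2 o (us.map fun u => Γ'.bit (b u)) (Γ'.bit (b u) :: sd) (us.flatMap g ++ ps) pd).seq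
            (Exec.push _ _ _))) ?_ (by omega)
        · funext k; cases k <;> simp [store]
        · funext k; cases k <;> simp [store, pairWord]
      · refine Exec.congr ((Exec.congr (T' := store (f u ++ (us.flatMap f ++ i)) o ow
          (us.map fun u => Γ'.bit (b u)) (Γ'.bit (b u) :: sd) (g u ++ (us.flatMap g ++ ps)) pd l [])
          (Exec.push _ _ _) ?_ le_rfl).seq ((Exec.congr (Exec.push _ _ _) ?_ le_rfl).seq
          (h2 (Γ'.blank :: o) (us.map fun u => Γ'.bit (b u)) (Γ'.bit (b u) :: sd)
            (us.flatMap g ++ ps) pd))) ?_ (by omega)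
        · funext k; cases k <;> simp [store]
        · funext k; cases k <;> simp [store]
        · funext k; cases k <;> simp [store, pairWord]
    · funext k; cases k <;> simp [store]
    · rw [List.length_cons]
      ring_nf
      omega

/-- Output a row of the player `p`. -/
def row (p : Bool) (cell : Bool → Prog) : Prog :=
  seq (rowLoop p cell) <| seq (pour .startDone .start) <| seq (pour .posDone .pos) <|
    push .out Γ'.comma

theorem exec_row {ι : Type} (p : Bool) (cell : Bool → Prog) (T : ℕ) (b : ι → Bool)
    (f g h : ι → List Γ') (us : List ι) (ow l : List Γ')
    (hcell : ∀ u ∈ us, ∀ i o s sd ps pd,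
      Exec (cell (b u)) (store (f u ++ i) o ow s sd (g u ++ ps) pd l [])
        (store i ((h u).reverse ++ o) ow s sd ps ((g u).reverse ++ pd) l []) T)
    (hg : (us.flatMap g).length ≤ us.length) (i o ps : List Γ') :
    Exec (row p cell)
      (store (us.flatMap f ++ i) o ow (us.map fun u => Γ'.bit (b u)) []
        (us.flatMap g ++ ps) [] l [])
      (store i ((us.flatMap (fun u => pairWord p (h u)) ++ [Γ'.comma]).reverse ++ o) ow
        (us.map fun u => Γ'.bit (b u)) [] (us.flatMap g ++ ps) [] l [])
      ((T + 7) * us.length + 7) := by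
  refine Exec.congr ((exec_rowLoop p cell T b f g h us ow l hcell i o [] ps []).seq
    ((Exec.pour (by decide) _).seq ((Exec.pour (by decide) _).seq (Exec.push _ _ _)))) ?_ ?_
  · funext k; cases k <;> simp [store]
  · simp only [store, List.append_nil, List.length_reverse, List.length_map, ne_eq, reduceCtorEq,
      not_false_eq_true, Function.update_of_ne]
    ring_nf
    omega

/-- Output the row of the player `p` at a node of the player `b`. -/
def ownerRow (b p : Bool) : Prog :=
  -- The loop runs once and pops the comma that ends the input row.
  if b = p then seq (row p (copyEntry p)) (loop .inp (fun _ => skip) fun _ => false)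
  else row p (forwardEntry p)

/-- Output the rows of all nodes. -/
def rows : Prog :=
  loop .own (fun o => match o with
    | some (Γ'.bit b) => seq (ownerRow b true) (seq (ownerRow b false) (push .pos Γ'.blank))
    | _ => skip) Option.isSome

/-- Output the owners and the start marks of all nodes, and keep them. -/
def readNodes : Prog :=
  loop .inp (fun o => match o with
    -- The owners are parked on `posDone`. The position stack receives a `ket` per node and finally
    -- a comma, which is its content for row 0.
    | some (Γ'.bit a) => seq (push .posDone (Γ'.bit a)) <| seq
        (loop .inp (fun o => match o with
          | some (Γ'.bit b) => seq (push .startDone (Γ'.bit b))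
              (pushList .out [Γ'.bit true, Γ'.bit b, Γ'.bit false, Γ'.bit false])
          | _ => skip) fun _ => false)
        (push .pos Γ'.ket)
    | _ => seq (push .out Γ'.comma) (push .pos Γ'.comma)) (fun o => match o with
    | some (Γ'.bit _) => true
    | _ => false)

theorem exec_readNodes {ι : Type} (a b : ι → Bool) (us : List ι) (i o sd ps pd l : List Γ') :
    Exec readNodes
      (store (us.flatMap (fun u => [Γ'.bit (a u), Γ'.bit (b u)]) ++ Γ'.comma :: i) o [] [] sd ps pd
        l [])
      (store i ((us.flatMap (fun u => [Γ'.bit true, Γ'.bit (b u), Γ'.bit false, Γ'.bit false]) ++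
          [Γ'.comma]).reverse ++ o) [] [] ((us.map fun u => Γ'.bit (b u)).reverse ++ sd)
        (Γ'.comma :: List.replicate us.length Γ'.ket ++ ps)
        ((us.map fun u => Γ'.bit (a u)).reverse ++ pd) l [])
      (11 * us.length + 3) := by
  induction us generalizing o sd ps pd with
  | nil =>
    refine Exec.congr (Exec.last_cons (a := Γ'.comma) (l := i) rfl rfl rfl
      ((Exec.push _ _ _).seq (Exec.push _ _ _))) ?_ (by simp)
    funext k; cases k <;> simp [store]
  | cons u us ih =>
    refine Exec.congr (Exec.again_cons (a := Γ'.bit (a u))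
      (l := Γ'.bit (b u) :: (us.flatMap (fun u => [Γ'.bit (a u), Γ'.bit (b u)]) ++ Γ'.comma :: i))
      rfl rfl rfl (t := 9) (Exec.congr ((Exec.push _ _ _).seq
        ((Exec.last_cons (a := Γ'.bit (b u))
          (l := us.flatMap (fun u => [Γ'.bit (a u), Γ'.bit (b u)]) ++ Γ'.comma :: i) ?_ rfl rfl
          ((Exec.push _ _ _).seq (Exec.pushList _ _ _))).seq (Exec.push _ _ _))) ?_ ?_)
      (ih ([Γ'.bit true, Γ'.bit (b u), Γ'.bit false, Γ'.bit false].reverse ++ o)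
        (Γ'.bit (b u) :: sd)
        (Γ'.ket :: ps) (Γ'.bit (a u) :: pd))) ?_ ?_
    · simp [store]
    · funext k; cases k <;> simp [store]
    · simp
    · funext k; cases k <;> simp [store, List.replicate_succ']
    · rw [List.length_cons]; omega

/-- Keep a word of the length of the input. -/
def measure : Prog :=
  loop .inp (fun o => match o with
    | some x => seq (push .lenDone x) (push .len x)
    | none => skip) Option.isSome

theorem exec_measure (i l ld : List Γ') :
    Exec measure (store i [] [] [] [] [] [] l ld)
      (store [] [] [] [] [] [] [] (i.reverse ++ l) (i.reverse ++ ld)) (3 * i.length + 2) := by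
  induction i generalizing l ld with
  | nil => exact Exec.last_nil rfl rfl (Exec.skip _)
  | cons a i ih =>
    refine Exec.congr (Exec.again_cons (a := a) (l := i) rfl rfl rfl
      (Exec.congr ((Exec.push _ _ _).seq (Exec.push _ _ _)) ?_ le_rfl) (ih (a :: l) (a :: ld))) ?_
      (by rw [List.length_cons]; omega)
    · funext k; cases k <;> simp [store]
    · funext k; cases k <;> simp [store]

/-- Output the encoding of the complete bipartite instance, in reverse order. -/
def transform : Prog :=
  seq measure <| seq (pour .lenDone .inp) <| seq readNodes <| seq (pour .startDone .start) <|
    seq (pour .posDone .own) rows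

/-- The reduction to complete bipartite graphs. -/
def reduction : Prog :=
  seq transform <| seq (clear .start) <| seq (clear .pos) <| seq (clear .len) <| pour .out .inp

end EnergyReduction

/-! ### Binary numerals and the numbering of the copies -/

namespace Computability

/-- Numerals start with the least significant digit. Hence a power of two can be written with a
stack as unary counter, without arithmetic. -/
theorem encodeNat_two_pow (k : ℕ) :
    encodeNat (2 ^ k) = List.replicate k false ++ [true] := by
  have h : ∃ p : PosNum, (p : ℕ) = 2 ^ k ∧ encodePosNum p = List.replicate k false ++ [true] := by
    induction k with
    | zero => exact ⟨1, by simp, rfl⟩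
    | succ k ih =>
      obtain ⟨p, h1, h2⟩ := ih
      refine ⟨p.bit0, ?_, ?_⟩
      · rw [PosNum.cast_bit0, h1]; ring
      · rw [encodePosNum, h2]; rfl
  obtain ⟨p, h1, h2⟩ := h
  have h3 : ((2 ^ k : ℕ) : Num) = Num.pos p := by
    rw [← h1]
    exact Num.of_to_nat (Num.pos p)
  rw [encodeNat, h3]
  exact h2

theorem lt_two_pow_length_encodeNat (m : ℕ) : m < 2 ^ (encodeNat m).length := by
  have hpos : ∀ p : PosNum, (p : ℕ) < 2 ^ (encodePosNum p).length := by
    intro p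
    induction p with
    | one => simp [encodePosNum]
    | bit0 p ih => rw [PosNum.cast_bit0, encodePosNum, List.length_cons, pow_succ]; omega
    | bit1 p ih => rw [PosNum.cast_bit1, encodePosNum, List.length_cons, pow_succ]; omega
  have h : ∀ a : Num, (a : ℕ) < 2 ^ (encodeNum a).length := by
    rintro (_ | p)
    · simp [encodeNum]
    · exact hpos p
  simpa [encodeNat] using h (m : Num)

end Computability

theorem List.length_le_length_flatMap {α β : Type} {f : α → List β} {l : List α} {a : α}
    (ha : a ∈ l) : (f a).length ≤ (l.flatMap f).length := by
  induction l with
  | nil => simp at ha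
  | cons b l ih =>
    rw [List.flatMap_cons, List.length_append]
    rcases List.mem_cons.mp ha with rfl | h
    · omega
    · have := ih h
      omega

/-- Node `2 * u` is the copy of `u` of Alice, and node `2 * u + 1` the copy of Bob. -/
def copies (n : ℕ) : Fin (n * 2) ≃ Fin n × Bool :=
  finProdFinEquiv.symm.trans (Equiv.prodCongr (Equiv.refl _) (finTwoEquiv.trans Equiv.boolNot))

theorem flatMap_finRange_copies {β : Type} (n : ℕ) (g : Fin n × Bool → List β) :
    (List.finRange (n * 2)).flatMap (fun a => g (copies n a)) =
      (List.finRange n).flatMap fun u => g (u, true) ++ g (u, false) := by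
  have h : List.finRange (n * 2) = (List.finRange n).flatMap fun u =>
      [(copies n).symm (u, true), (copies n).symm (u, false)] := by
    rw [← List.ofFn_id, List.ofFn_mul, List.flatMap_def, List.ofFn_eq_map]
    congr 1
    refine List.map_congr_left fun u _ => ?_
    simp only [List.ofFn_succ, List.ofFn_zero, List.cons.injEq, and_true, id]
    constructor <;> refine Fin.ext ?_ <;> simp [copies, finProdFinEquiv, finTwoEquiv] <;> ring
  rw [h, List.flatMap_assoc]
  simp

theorem GameGraph.IsCompleteBipartite.relabel {V U : Type} {G : GameGraph U}
    (h : G.IsCompleteBipartite) (e : V ≃ U) : (G.relabel e).IsCompleteBipartite :=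
  ⟨fun u v => h.1 (e u) (e v), fun u v => h.2 (e u) (e v)⟩

/-! ### The reduced instance and its encoding -/

namespace EnergyReduction

open StackProg Computability EnergyInstance

theorem encodeEntry_penalty {V : Type} [DecidableEq V] (s u : V) (L : ℕ) (p : Bool) :
    encodeEntry (some (GameGraph.penalty s (2 ^ L) p u)) = penaltyWord p (decide (u = s)) L := by
  have hpos : (0 : ℤ) < 2 ^ L := by positivity
  have hneg : (-(2 ^ L : ℤ)) < 0 := by omega
  have habs : ((2 : ℤ) ^ L).natAbs = 2 ^ L := by simp [Int.natAbs_pow]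
  have hdouble : (2 : ℤ) * 2 ^ L = 2 ^ (L + 1) := by ring
  have hpos' : (0 : ℤ) < 2 ^ (L + 1) := by positivity
  have habs' : ((2 : ℤ) ^ (L + 1)).natAbs = 2 ^ (L + 1) := by simp [Int.natAbs_pow]
  unfold GameGraph.penalty encodeEntry penaltyWord
  by_cases hu : u = s <;> cases p <;>
    simp [hu, hdouble, habs, habs', encodeNat_two_pow, List.replicate_succ', hpos.le, hpos'.le]

/-- The complete bipartite instance for `I`. -/
def reduced (I : EnergyInstance) : EnergyInstance where
  n := I.n * 2
  graph := (I.graph.completion I.s (2 ^ I.encode.length)).relabel (copies I.n)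
  s := (copies I.n).symm (I.s, true)

theorem reduced_isCompleteBipartite (I : EnergyInstance) :
    (reduced I).graph.IsCompleteBipartite :=
  GameGraph.completion_isCompleteBipartite.relabel _

theorem length_flatMap_encodeNode (I : EnergyInstance) :
    ((List.finRange I.n).flatMap I.encodeNode).length = 2 * I.n := by
  simp [encodeNode, List.length_flatMap, mul_comm]

theorem length_encodeEntry_le (I : EnergyInstance) (x u : Fin I.n) :
    2 * I.n + 1 + (encodeEntry (I.graph.weight x u)).length ≤ I.encode.length := by
  have h1 := List.length_le_length_flatMap (f := I.encodeRow) (List.mem_finRange x)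
  have h2 := List.length_le_length_flatMap (f := fun v => encodeEntry (I.graph.weight x v))
    (List.mem_finRange u)
  have h3 := length_flatMap_encodeNode I
  simp only [encodeRow, List.length_append, List.length_singleton] at h1
  simp only [encode, List.length_append, List.length_cons]
  omega

theorem card_le_length_encode (I : EnergyInstance) : 2 * I.n + 1 ≤ I.encode.length := by
  have h3 := length_flatMap_encodeNode I
  simp only [encode, List.length_append, List.length_cons]
  omega

/-- The node list and its comma take `2 * n + 1` symbols of the input, which are not available for
the digits of a weight. -/
theorem abs_w_le (I : EnergyInstance) (x y : Fin I.n) (h : I.graph.Adj x y) :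
    |I.graph.w x y| ≤ 2 ^ (I.encode.length - 2 * I.n - 1) := by
  obtain ⟨z, hz⟩ := Option.isSome_iff_exists.mp h
  have h1 := length_encodeEntry_le I x y
  have h2 := lt_two_pow_length_encodeNat z.natAbs
  rw [hz] at h1
  simp only [encodeEntry, List.length_cons, List.length_append, List.length_map,
    List.length_nil] at h1
  have h3 : 2 ^ (encodeNat z.natAbs).length ≤ 2 ^ (I.encode.length - 2 * I.n - 1) :=
    Nat.pow_le_pow_right (by norm_num) (by omega)
  have h4 : z.natAbs ≤ 2 ^ (I.encode.length - 2 * I.n - 1) := by omega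
  rw [GameGraph.w, hz, Option.getD_some, Int.abs_eq_natAbs]
  exact_mod_cast h4

theorem reduced_aliceWins_iff (I : EnergyInstance) :
    (reduced I).graph.AliceWins (reduced I).s ↔ I.graph.AliceWins I.s := by
  -- Since `2 * n < 2 ^ (2 * n)`, the left side is even below `2 ^ (L - 1)`, where `L` is the input
  -- length.
  have hM : 2 * (Fintype.card (Fin I.n) : ℤ) * 2 ^ (I.encode.length - 2 * I.n - 1) <
      2 ^ I.encode.length := by
    have h1 := card_le_length_encode I
    have h2 : I.encode.length = 2 * I.n + (I.encode.length - 2 * I.n - 1) + 1 := by omega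
    have h3 : 2 * I.n < 2 ^ (2 * I.n) := Nat.lt_two_pow_self
    have h4 : 0 < 2 ^ (I.encode.length - 2 * I.n - 1) := by positivity
    rw [Fintype.card_fin]
    conv_rhs => rw [h2, pow_succ, pow_add]
    norm_cast
    nlinarith
  have hW : (0 : ℤ) ≤ 2 ^ (I.encode.length - 2 * I.n - 1) := by positivity
  unfold reduced
  rw [GameGraph.aliceWins_relabel_iff, Equiv.apply_symm_apply]
  exact ⟨.of_completion hW (abs_w_le I) hM, .completion hW (abs_w_le I) hM⟩

/-- The symbol for the position of `u` relative to the current row `x`. -/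
def position {n : ℕ} (x u : Fin n) : Γ' :=
  if u < x then .blank else if u = x then .comma else .ket

/-- The output for the nonmissing entry of the row of the player `p` at `x` in column `u`. -/
def cellWord (I : EnergyInstance) (p : Bool) (x u : Fin I.n) : List Γ' :=
  if I.graph.alice x = p then
    entryWord p (decide (u = I.s)) I.encode.length (I.graph.weight x u)
  else forwardWord p (decide (u = I.s)) I.encode.length (position x u)

/-- The output for the row of the player `p` at `x`. -/
def rowWord (I : EnergyInstance) (p : Bool) (x : Fin I.n) : List Γ' :=
  (List.finRange I.n).flatMap (fun u => pairWord p (cellWord I p x u)) ++ [.comma]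

theorem encodeEntry_completion (I : EnergyInstance) (p : Bool) (x u : Fin I.n) :
    encodeEntry ((I.graph.completion I.s (2 ^ I.encode.length)).weight (x, p) (u, !p)) =
      cellWord I p x u := by
  have hp : ¬ p = !p := by simp
  simp only [GameGraph.completion, if_neg hp, cellWord]
  split_ifs with h1 h2
  · cases hw : I.graph.weight x u with
    | none => simp [entryWord, encodeEntry_penalty]
    | some z => simp [entryWord]
  · subst h2
    simp [forwardWord, position, encodeEntry, encodeNat, encodeNum]
  · have h3 : position x u ≠ .comma := by
      unfold position
      split_ifs with h4 h5
      · simp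
      · exact absurd h5.symm h2
      · simp
    simp [forwardWord, h3, encodeEntry_penalty]

/-- The copies of a node are adjacent in the numbering, so the encoding can be produced node by node
in one pass over the input. -/
theorem encode_reduced (I : EnergyInstance) : (reduced I).encode =
    (List.finRange I.n).flatMap
        (fun u => [.bit true, .bit (decide (u = I.s)), .bit false, .bit false]) ++
      .comma :: (List.finRange I.n).flatMap fun x => rowWord I true x ++ rowWord I false x := by
  have hnode : (List.finRange (reduced I).n).flatMap (reduced I).encodeNode =
      (List.finRange I.n).flatMap
        (fun u => [.bit true, .bit (decide (u = I.s)), .bit false, .bit false]) := by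
    refine Eq.trans ?_ ((flatMap_finRange_copies I.n fun v =>
      [Γ'.bit v.2, Γ'.bit (decide (v = (I.s, true)))]).trans ?_)
    · refine List.flatMap_congr fun (a : Fin (I.n * 2)) _ => ?_
      change [Γ'.bit (copies I.n a).2, Γ'.bit (decide (a = (copies I.n).symm (I.s, true)))] = _
      simp [Equiv.eq_symm_apply]
    · simp
  have hrow : ∀ v : Fin I.n × Bool, (List.finRange (I.n * 2)).flatMap (fun b => encodeEntry
      ((I.graph.completion I.s (2 ^ I.encode.length)).weight v (copies I.n b))) ++ [Γ'.comma] =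
      rowWord I v.2 v.1 := by
    rintro ⟨x, p⟩
    rw [flatMap_finRange_copies I.n fun w => encodeEntry
      ((I.graph.completion I.s (2 ^ I.encode.length)).weight (x, p) w), rowWord]
    congr 1
    refine List.flatMap_congr fun u _ => ?_
    rw [← encodeEntry_completion]
    cases p <;> simp [pairWord, GameGraph.completion, encodeEntry]
  have hrows : (List.finRange (reduced I).n).flatMap (reduced I).encodeRow =
      (List.finRange I.n).flatMap fun x => rowWord I true x ++ rowWord I false x := by
    refine Eq.trans ?_ (flatMap_finRange_copies I.n fun v => rowWord I v.2 v.1)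
    refine List.flatMap_congr fun a _ => ?_
    rw [← hrow]
    rfl
  rw [encode, hnode, hrows]

end EnergyReduction

/-- A step pushes at most one symbol. So a time bound also bounds the output, and with it the cost
of reversing the output at the end. -/
theorem StackProg.Exec.length_le {K A : Type} [DecidableEq K] {p : StackProg K A}
    {S T : K → List A} {t : ℕ} (h : Exec p S T t) (k : K) : (T k).length ≤ (S k).length + t := by
  have hpop : ∀ (S : K → List A) k',
      (Function.update S k' (S k').tail k).length ≤ (S k).length := by
    intro S k'
    by_cases hk : k = k'
    · subst hk; simp
    · simp [hk]
  induction h with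
  | skip S => omega
  | push k' a S =>
    by_cases hk : k = k'
    · subst hk; simp
    · simp [hk]
  | seq _ _ ih1 ih2 => omega
  | @last k' _ _ S _ _ _ _ ih => have := hpop S k'; omega
  | @again k' _ _ S _ _ _ _ _ _ _ ih1 ih2 => have := hpop S k'; omega
  | mono _ _ ih => omega

/-! ### Correctness and running time of the program -/

namespace EnergyReduction

open StackProg Computability EnergyInstance

/-- The position stack at the row `k` of `n`. -/
def positions (n k : ℕ) : List Γ' :=
  List.replicate k .blank ++ .comma :: List.replicate n .ket

/-- The top `n` symbols are those read in row `x`; the other `x + 1` stay below. One more blank on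
top shifts the diagonal mark to the next column. -/
theorem positions_eq {n : ℕ} (x : Fin n) : positions n x =
    (List.finRange n).flatMap (fun u => [position x u]) ++ List.replicate (x + 1) .ket := by
  have h : (List.finRange n).flatMap (fun u => [position x u]) =
      (List.finRange n).map (position x) := List.map_eq_flatMap.symm
  rw [h]
  have hx := x.2
  refine List.ext_getElem (by simp [positions]; omega) fun i h1 h2 => ?_
  by_cases hi : i < n
  · rw [List.getElem_append_left (by simpa using hi)]
    simp only [positions, List.getElem_map, List.getElem_finRange, position, Fin.lt_def,
      Fin.ext_iff, Fin.val_cast]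
    rcases lt_trichotomy i x with h3 | h3 | h3
    · simp [h3]
    · simp [h3]
    · rw [List.getElem_append_right (by simp; omega), List.getElem_cons]
      simp only [List.length_replicate, List.getElem_replicate]
      rw [dif_neg (by omega), if_neg (by omega), if_neg (by omega)]
  · rw [List.getElem_append_right (by simpa using hi)]
    simp only [positions]
    rw [List.getElem_append_right (by simp; omega), List.getElem_cons, dif_neg (by simp; omega)]
    simp

/-- The start marks of the nodes. -/
def startMarks (I : EnergyInstance) : List Γ' :=
  (List.finRange I.n).map fun u => .bit (decide (u = I.s))

/-- Of the two rows for `x`, only the owner's reads the input row; the other is determined by the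
position stack and the start marks. -/
theorem exec_ownerRow (I : EnergyInstance) (p : Bool) (x : Fin I.n) {l : List Γ'}
    (hl : l.length = I.encode.length) (i o ow : List Γ') :
    Exec (ownerRow (I.graph.alice x) p)
      (store ((if I.graph.alice x = p then I.encodeRow x else []) ++ i) o ow (startMarks I) []
        (positions I.n x) [] l [])
      (store i ((rowWord I p x).reverse ++ o) ow (startMarks I) [] (positions I.n x) [] l [])
      ((7 * I.encode.length + 20) * I.n + 9) := by
  by_cases h : I.graph.alice x = p
  · simp only [ownerRow, if_pos h]
    have hrow := exec_row p (copyEntry p) (7 * I.encode.length + 13)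
      (fun u => decide (u = I.s)) (fun u => encodeEntry (I.graph.weight x u)) (fun _ => [])
      (cellWord I p x) (List.finRange I.n) ow l (fun u _ i o s sd ps pd => by
        have h1 := length_encodeEntry_le I x u
        have h2 := exec_copyEntry p (decide (u = I.s)) (I.graph.weight x u) i o ow s sd ps pd l
        rw [hl] at h2
        simp only [cellWord, if_pos h]
        exact h2.mono (by omega)) (by simp) (.comma :: i) o (positions I.n x)
    rw [show (List.finRange I.n).flatMap (fun _ => ([] : List Γ')) = [] by simp,
      List.nil_append] at hrow
    rw [List.length_finRange] at hrow
    rw [encodeRow, List.append_assoc]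
    refine Exec.congr (hrow.seq (Exec.last_cons (a := .comma) (l := i) rfl ?_ rfl (Exec.skip _)))
      rfl (by ring_nf; omega)
    funext k; cases k <;> simp [store, startMarks, rowWord]
  · simp only [ownerRow, if_neg h, List.nil_append]
    have hrow := exec_row p (forwardEntry p) (7 * I.encode.length + 13)
      (fun u => decide (u = I.s)) (fun _ => []) (fun u => [position x u])
      (cellWord I p x) (List.finRange I.n) ow l (fun u _ i o s sd ps pd => by
        have h2 := exec_forwardEntry p (decide (u = I.s)) (position x u) i o ow s sd ps pd l
        rw [hl] at h2
        simp only [cellWord, if_neg h]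
        exact h2.mono (by omega)) (by simp) i o (List.replicate (x + 1) .ket)
    rw [show (List.finRange I.n).flatMap (fun _ => ([] : List Γ')) = [] by simp,
      List.nil_append, ← positions_eq, List.length_finRange] at hrow
    exact hrow.mono (by ring_nf; omega)

theorem exec_rows (I : EnergyInstance) {l : List Γ'} (hl : l.length = I.encode.length)
    (us : List (Fin I.n)) (k : ℕ) (hus : us.map (fun u => u.val) = List.range' k us.length)
    (o : List Γ') :
    Exec rows
      (store (us.flatMap I.encodeRow) o (us.map fun u => .bit (I.graph.alice u)) (startMarks I) []
        (positions I.n k) [] l [])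
      (store [] ((us.flatMap fun x => rowWord I true x ++ rowWord I false x).reverse ++ o) []
        (startMarks I) [] (positions I.n (k + us.length)) [] l [])
      ((2 * ((7 * I.encode.length + 20) * I.n + 9) + 2) * us.length + 2) := by
  induction us generalizing k o with
  | nil => exact Exec.last_nil rfl rfl (Exec.skip _)
  | cons x us ih =>
    simp only [List.map_cons, List.length_cons, List.range'_succ, List.cons.injEq] at hus
    obtain ⟨rfl, hus⟩ := hus
    have h1 := exec_ownerRow I true x hl
      ((if I.graph.alice x = false then I.encodeRow x else []) ++ us.flatMap I.encodeRow) o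
      (us.map fun u => .bit (I.graph.alice u))
    have h2 := exec_ownerRow I false x hl (us.flatMap I.encodeRow)
      ((rowWord I true x).reverse ++ o) (us.map fun u => .bit (I.graph.alice u))
    have h3 := ih (x + 1) hus ((rowWord I false x).reverse ++ ((rowWord I true x).reverse ++ o))
    have h4 := h1.seq (h2.seq (Exec.congr (Exec.push .pos .blank _)
      (T' := store (us.flatMap I.encodeRow)
        ((rowWord I false x).reverse ++ ((rowWord I true x).reverse ++ o))
        (us.map fun u => .bit (I.graph.alice u)) (startMarks I) [] (positions I.n (x + 1)) [] l [])
      (by funext k; cases k <;> simp [store, positions, List.replicate_succ]) le_rfl))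
    refine Exec.congr (Exec.again_cons (a := Γ'.bit (I.graph.alice x))
      (l := us.map fun u => Γ'.bit (I.graph.alice u)) rfl ?_ rfl h4 h3) ?_ ?_
    · funext k
      cases hx : I.graph.alice x <;> cases k <;> simp [store]
    · rw [List.length_cons, show (x : ℕ) + 1 + us.length = x + (us.length + 1) by omega]
      funext k; cases k <;> simp [store]
    · rw [List.length_cons]
      ring_nf
      omega

theorem exec_transform (I : EnergyInstance) :
    Exec transform (store I.encode [] [] [] [] [] [] [] [])
      (store [] (reduced I).encode.reverse [] (startMarks I) [] (positions I.n I.n) []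
        I.encode.reverse [])
      (14 * I.encode.length * I.n ^ 2 + 40 * I.n ^ 2 + 35 * I.n + 5 * I.encode.length + 13) := by
  set w : List Γ' := (List.finRange I.n).flatMap fun u =>
    [.bit true, .bit (decide (u = I.s)), .bit false, .bit false] with hw
  have h1 : Exec (pour .lenDone .inp)
      (store [] [] [] [] [] [] [] (I.encode.reverse ++ []) (I.encode.reverse ++ []))
      (store I.encode [] [] [] [] [] [] I.encode.reverse []) (2 * I.encode.length + 2) := by
    refine Exec.congr (Exec.pour (by decide) _) ?_ ?_
    · funext k; cases k <;> simp [store]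
    · simp [store]
  have h2 := exec_readNodes I.graph.alice (fun u => decide (u = I.s)) (List.finRange I.n)
    ((List.finRange I.n).flatMap I.encodeRow) [] [] [] [] I.encode.reverse
  have h3 := exec_rows I (l := I.encode.reverse) (by simp) (List.finRange I.n) 0
    (by
      rw [List.map_coe_finRange_eq_range, List.range_eq_range', List.length_finRange])
    (w ++ [Γ'.comma]).reverse
  rw [← List.reverse_append, List.append_assoc, List.singleton_append, ← encode_reduced,
    List.length_finRange, zero_add] at h3
  refine Exec.congr ((exec_measure I.encode [] []).seq (h1.seq (h2.seq
    ((Exec.pour (by decide) _).seq ((Exec.congr (Exec.pour (by decide) _) ?_ le_rfl).seq h3)))))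
    rfl ?_
  · funext k; cases k <;> simp [store, startMarks, positions, hw]
  · simp [store]
    ring_nf
    omega

theorem exec_reduction (I : EnergyInstance) :
    Exec reduction (Function.update (fun _ => []) .inp I.encode)
      (Function.update (fun _ => []) .inp (reduced I).encode)
      (200 * (I.encode.length + 1) ^ 3) := by
  have hS : Function.update (fun _ => []) Stack.inp I.encode =
      store I.encode [] [] [] [] [] [] [] [] := by
    funext k; cases k <;> simp [store]
  have h := exec_transform I
  have hout := h.length_le .out
  have hnL := card_le_length_encode I
  simp only [store, List.length_reverse, List.length_nil, zero_add] at hout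
  rw [hS]
  refine Exec.congr (h.seq ((Exec.clear _ _).seq ((Exec.clear _ _).seq ((Exec.clear _ _).seq
    (Exec.pour (by decide) _))))) ?_ ?_
  · funext k; cases k <;> simp [store]
  · simp only [store, startMarks, positions, List.length_reverse, List.length_map, ne_eq,
      reduceCtorEq, not_false_eq_true, Function.update_of_ne, List.length_finRange,
      List.length_append, List.length_replicate, List.length_cons]
    -- There are quadratically many entries in `n`, each written in time linear in the input length.
    -- With `n` at most this length the total is cubic.
    have h1 : I.n ≤ I.encode.length := by omega
    have h2 : I.n ^ 2 ≤ I.encode.length ^ 2 := Nat.pow_le_pow_left h1 2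
    have h3 : I.encode.length * I.n ^ 2 ≤ I.encode.length * I.encode.length ^ 2 :=
      Nat.mul_le_mul_left _ h2
    ring_nf at hout h3 ⊢
    omega

end EnergyReduction

theorem mainTheorem6 :
    completeBipartiteEnergyDecision.PolyTimeEquivalent energyDecision := by
  constructor
  -- A complete bipartite instance is encoded by the same word as a general one, so the identity
  -- machine computes the inclusion.
  · refine ⟨Subtype.val, ⟨{ Turing.idComputableInPolyTime EnergyInstance.encode with
      outputsFun := fun I =>
        (Turing.idComputableInPolyTime EnergyInstance.encode).outputsFun I.1 }⟩, fun I => Iff.rfl⟩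
  · refine ⟨fun I => ⟨EnergyReduction.reduced I, EnergyReduction.reduced_isCompleteBipartite I⟩,
      StackProg.computableInPolyTime EnergyReduction.reduction .inp
        (200 * (Polynomial.X + 1) ^ 3) fun I => ?_, fun I => ?_⟩
    · simpa [energyDecision, completeBipartiteEnergyDecision] using
        EnergyReduction.exec_reduction I
    · change I.graph.minEnergy I.s < ⊤ ↔
        (EnergyReduction.reduced I).graph.minEnergy (EnergyReduction.reduced I).s < ⊤
      exact (GameGraph.minEnergy_lt_top_iff _).trans
        ((EnergyReduction.reduced_aliceWins_iff I).symm.trans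
          (GameGraph.minEnergy_lt_top_iff _).symm)
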